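/- Let $m\ge 2$, $n=2m+1$, and let $C_n$ be the cycle graph on $n$ vertices with its shortest-path metric $d$. A $k$-simplex is a tuple $\underline{x}=(x_0,\dots,x_k)$ of vertices with consecutive entries distinct; its length is $\ell(\underline{x})=\sum_i d(x_{i-1},x_i)$. Let $\mathrm{MC}^k_\ell(C_n)$ be the group of integer-valued functions on the $k$-simplices of length $\ell$, with differential $\partial^*\colon \mathrm{MC}^{k}_\ell\to\mathrm{MC}^{k+1}_\ell$, $$(\partial^*\varphi)(x_0,\dots,x_{k+1})=\sum_{i}(-1)^i\varphi(x_0,\dots,\widehat{x_i},\dots,x_{k+1}),$$ the sum being over those $1\le i\le k$ with $d(x_{i-1},x_{i+1})=d(x_{i-1},x_i)+d(x_i,x_{i+1})$, and with product $$(\varphi\cdot\psi)(x_0,\dots,x_{k+k'})=\varphi(x_0,\dots,x_k)\,\psi(x_k,\dots,x_{k+k'})\qquad(\varphi \text{ of degree } k,\ \psi\text{ of degree }k').$$ The magnitude cohomology ring $\mathrm{MH}^*_*(C_n)=\bigoplus_{k,\ell}\mathrm{MH}^k_\ell(C_n)$ is the cohomology of $(\mathrm{MC}^*_*(C_n),\partial^*)$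 with the induced product; its unit is the class of the cochain with value $1$ on every $0$-simplex. Theorem. The following cochains are cocycles; denote their classes as indicated. - For each vertex $x$, let $e_x\in\mathrm{MH}^0_0(C_n)$ be the class of the cochain with value $1$ on $(x)$ and $0$ on all other simplices. - For each oriented edge $xy$, let $a_{xy}\in\mathrm{MH}^1_1(C_n)$ be the class of the cochain with value $1$ on $(x,y)$ and $0$ on all other simplices. - For each ordered pair $x,z$ with $d(x,z)=m$, let $b_{xz}\in\mathrm{MH}^2_{m+1}(C_n)$ be the class of the cochain with value $1$ on every $2$-simplex $(x,y,z)$ of length $m+1$ with endpoints $x$ and $z$, and $0$ on all other simplices. The bigraded ring $\mathrm{MH}^*_*(C_n)$ is presented, as an associative (not necessarily unital) ring, by the generators $e_x$, $a_{xy}$, $b_{xz}$ and the relations - $e_x^2=e_x$ for every vertex $x$, and $e_xe_y=0$ for distinct vertices $x,y$; - $a_{xy}=e_xa_{xy}=a_{xy}e_y$ for every oriented edge $xy$; - $b_{xz}=e_xb_{xz}=b_{xz}e_z$ for all $x,z$ with $d(x,z)=m$; - $a_{xy}a_{yz}=0$ for oriented edges $xy$, $yz$ with $x\ne z$; - $a_{wx}b_{xz}=b_{wy}a_{yz}$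 for all $w,x,y,z$ in cyclic order (in either direction around the cycle) with $d(w,x)=1$, $d(x,y)=m$, $d(y,z)=1$ and $d(x,z)=d(w,y)=m$. That is, the ring given by this presentation is isomorphic to $\mathrm{MH}^*_*(C_n)$ by an isomorphism that sends each generator to the class of the same name and that maps, for all $k,\ell$, the subgroup spanned by the words of bidegree $(k,\ell)$ in the generators onto $\mathrm{MH}^k_\ell(C_n)$, where $e_x$, $a_{xy}$, $b_{xz}$ have bidegrees $(0,0)$, $(1,1)$, $(2,m+1)$. Moreover $\sum_x e_x=1$. -/

import Mathlib

namespace MagnitudeCohomology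

/-! ### Simplices -/

/-- The tuple `(x₀, …, x_k)`, written as the list `[x₀, …, x_k]`, is a simplex: it is nonempty and
its consecutive entries are distinct. Its degree is `k`, one less than the length of the list. -/
def IsSimplex {V : Type*} (x : List V) : Prop :=
  x ≠ [] ∧ x.IsChain (· ≠ ·)

/-- The length `ℓ(x₀, …, x_k) = d(x₀, x₁) + ⋯ + d(x_{k-1}, x_k)` of a tuple of vertices of a
connected graph, where `d` is the shortest-path metric. -/
noncomputable def tupleLength {V : Type*} (G : SimpleGraph V) : List V → ℕ
  | [] => 0
  | [_] => 0
  | x :: y :: l => G.dist x y + tupleLength G (y :: l)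

/-! ### Cochains

A cochain of bidegree `(k, ℓ)` is an integer-valued function on the simplices of degree `k` and
length `ℓ`, that is, a homomorphism to `ℤ` from the free abelian group on these simplices.
An element of the direct sum over all bidegrees is a function on all simplices that is supported in
finitely many bidegrees. We extend these functions by zero to all lists. -/

/-- The magnitude cochains of `G`, of all bidegrees together: the direct sum over all `(k, ℓ)` of
the groups of cochains of bidegree `(k, ℓ)`. -/
def Cochain {V : Type*} (G : SimpleGraph V) : AddSubgroup (List V → ℤ) where
  carrier := {f | (∀ x, f x ≠ 0 → IsSimplex x) ∧
    ∃ N : ℕ, ∀ x, f x ≠ 0 → x.length ≤ N + 1 ∧ tupleLength G x ≤ N}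
  zero_mem' := ⟨fun x h => absurd rfl h, 0, fun x h => absurd rfl h⟩
  add_mem' := by
    rintro f g ⟨hf, N, hN⟩ ⟨hg, M, hM⟩
    have key : ∀ x, (f + g) x ≠ 0 → f x ≠ 0 ∨ g x ≠ 0 := by
      intro x hx
      by_contra! h
      exact hx (by simp [h.1, h.2])
    refine ⟨fun x hx => (key x hx).elim (hf x) (hg x), max N M, fun x hx => ?_⟩
    rcases key x hx with h | h
    · have := hN x h
      omega
    · have := hM x h
      omega
  neg_mem' := by
    rintro f ⟨hf, N, hN⟩
    exact ⟨fun x hx => hf x (by simpa using hx), N, fun x hx => hN x (by simpa using hx)⟩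

/-- The product of cochains: for `φ` of degree `k₁` and `ψ` of degree `k₂`,
`(φ · ψ)(x₀, …, x_{k₁+k₂}) = φ(x₀, …, x_{k₁}) ψ(x_{k₁}, …, x_{k₁+k₂})`, extended bilinearly to sums
of cochains of different degrees. -/
def mulFun {V : Type*} (f g : List V → ℤ) (x : List V) : ℤ :=
  ∑ i ∈ Finset.range x.length, f (x.take (i + 1)) * g (x.drop i)

/-- The unit cochain, with value `1` on every simplex of degree `0`. -/
def oneFun {V : Type*} (x : List V) : ℤ :=
  if x.length = 1 then 1 else 0

open Classical in
/-- The differential, dual to `∂ = ∑_{0 < i < k} (-1)^i ∂_i`, where `∂_i` omits the entry `x_i` of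
`(x₀, …, x_k)` if `d(x_{i-1}, x_{i+1}) = d(x_{i-1}, x_i) + d(x_i, x_{i+1})`, equivalently if
omitting `x_i` does not change the length of the tuple, and is zero otherwise. -/
noncomputable def dFun {V : Type*} (G : SimpleGraph V) (f : List V → ℤ) (x : List V) : ℤ :=
  if IsSimplex x then
    ∑ i ∈ Finset.Ico 1 (x.length - 1),
      if tupleLength G (x.eraseIdx i) = tupleLength G x then (-1) ^ i * f (x.eraseIdx i) else 0
  else 0

/-! ### Helper facts: cutting a tuple in two, the ring axioms and the Leibniz rule -/

theorem IsSimplex.take {V : Type*} {x : List V} (h : IsSimplex x) (i : ℕ) :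
    IsSimplex (x.take (i + 1)) :=
  ⟨by simp [h.1], h.2.take _⟩

theorem IsSimplex.drop {V : Type*} {x : List V} (h : IsSimplex x) {i : ℕ} (hi : i < x.length) :
    IsSimplex (x.drop i) :=
  ⟨by simpa using hi, h.2.drop _⟩

theorem isSimplex_of_take_drop {V : Type*} (x : List V) (i : ℕ)
    (h₁ : IsSimplex (x.take (i + 1))) (h₂ : IsSimplex (x.drop i)) : IsSimplex x := by
  induction x generalizing i with
  | nil => simpa using h₁
  | cons a l ih =>
    cases i with
    | zero => simpa using h₂
    | succ i =>
      refine ⟨by simp, ?_⟩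
      have hl : l ≠ [] := by
        rintro rfl
        exact h₂.1 (by simp)
      obtain ⟨b, l', rfl⟩ := List.exists_cons_of_ne_nil hl
      have h₁' := h₁.2
      simp only [List.take_succ_cons, List.isChain_cons_cons] at h₁'
      have := ih i ⟨by simp, by simpa using h₁'.2⟩ (by simpa using h₂)
      exact List.isChain_cons_cons.2 ⟨h₁'.1, this.2⟩

theorem tupleLength_split {V : Type*} (G : SimpleGraph V) (x : List V) (i : ℕ)
    (hi : i < x.length) :
    tupleLength G (x.take (i + 1)) + tupleLength G (x.drop i) = tupleLength G x := by
  induction x generalizing i with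
  | nil => simp at hi
  | cons a l ih =>
    cases i with
    | zero => simp [tupleLength]
    | succ i =>
      have hl : l ≠ [] := by
        rintro rfl
        simp at hi
      obtain ⟨b, l', rfl⟩ := List.exists_cons_of_ne_nil hl
      have := ih i (by simpa using hi)
      simp only [List.take_succ_cons, List.drop_succ_cons, tupleLength] at this ⊢
      omega

theorem exists_of_mulFun_ne_zero {V : Type*} {f g : List V → ℤ} {x : List V}
    (h : mulFun f g x ≠ 0) : ∃ i < x.length, f (x.take (i + 1)) ≠ 0 ∧ g (x.drop i) ≠ 0 := by
  obtain ⟨i, hi, h'⟩ := Finset.exists_ne_zero_of_sum_ne_zero h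
  exact ⟨i, by simpa using hi, left_ne_zero_of_mul h', right_ne_zero_of_mul h'⟩

theorem mulFun_mem {V : Type*} {G : SimpleGraph V} {f g : List V → ℤ} (hf : f ∈ Cochain G)
    (hg : g ∈ Cochain G) : mulFun f g ∈ Cochain G := by
  obtain ⟨hf, N, hN⟩ := hf
  obtain ⟨hg, M, hM⟩ := hg
  refine ⟨fun x hx => ?_, N + M, fun x hx => ?_⟩
  · obtain ⟨i, -, h₁, h₂⟩ := exists_of_mulFun_ne_zero hx
    exact isSimplex_of_take_drop x i (hf _ h₁) (hg _ h₂)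
  · obtain ⟨i, hi, h₁, h₂⟩ := exists_of_mulFun_ne_zero hx
    have a := hN _ h₁
    have b := hM _ h₂
    have c := tupleLength_split G x i hi
    simp only [List.length_take, List.length_drop] at a b
    omega

theorem oneFun_mem {V : Type*} (G : SimpleGraph V) : oneFun ∈ Cochain G := by
  have key : ∀ x : List V, oneFun x ≠ 0 → ∃ a, x = [a] := by
    intro x hx
    refine List.length_eq_one_iff.1 ?_
    by_contra h
    exact hx (if_neg h)
  refine ⟨fun x hx => ?_, 0, fun x hx => ?_⟩
  · obtain ⟨a, rfl⟩ := key x hx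
    exact ⟨by simp, by simp⟩
  · obtain ⟨a, rfl⟩ := key x hx
    simp [tupleLength]

theorem dFun_mem {V : Type*} {G : SimpleGraph V} {f : List V → ℤ} (hf : f ∈ Cochain G) :
    dFun G f ∈ Cochain G := by
  obtain ⟨-, N, hN⟩ := hf
  refine ⟨fun x hx => ?_, N + 1, fun x hx => ?_⟩
  · by_contra h
    exact hx (if_neg h)
  · unfold dFun at hx
    split_ifs at hx with h
    · obtain ⟨i, hi, h'⟩ := Finset.exists_ne_zero_of_sum_ne_zero hx
      split_ifs at h' with hl
      · have a := hN _ (right_ne_zero_of_mul h')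
        have b := List.length_eraseIdx_add_one (l := x) (i := i)
          (by have := Finset.mem_Ico.1 hi; omega)
        omega
      · exact absurd rfl h'
    · exact absurd rfl hx

theorem mulFun_assoc {V : Type*} (f g h : List V → ℤ) :
    mulFun (mulFun f g) h = mulFun f (mulFun g h) := by
  funext x
  simp only [mulFun, Finset.sum_mul, Finset.mul_sum]
  rw [Finset.sum_sigma', Finset.sum_sigma']
  refine Finset.sum_bij' (fun p _ => ⟨p.2, p.1 - p.2⟩) (fun p _ => ⟨p.1 + p.2, p.1⟩) ?_ ?_ ?_ ?_ ?_
  · rintro ⟨i, j⟩ hp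
    simp only [Finset.mem_sigma, Finset.mem_range, List.length_take, List.length_drop] at hp ⊢
    omega
  · rintro ⟨i, j⟩ hp
    simp only [Finset.mem_sigma, Finset.mem_range, List.length_take, List.length_drop] at hp ⊢
    omega
  · rintro ⟨i, j⟩ hp
    simp only [Finset.mem_sigma, Finset.mem_range, List.length_take] at hp ⊢
    rw [Nat.add_sub_cancel' (by omega)]
  · rintro ⟨i, j⟩ hp
    simp
  · rintro ⟨i, j⟩ hp
    simp only [Finset.mem_sigma, Finset.mem_range, List.length_take] at hp
    simp only [List.take_take, List.drop_drop, List.drop_take]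
    rw [min_eq_left (by omega), Nat.add_sub_cancel' (by omega : j ≤ i), mul_assoc,
      show i - j + 1 = i + 1 - j by omega]

theorem oneFun_mulFun {V : Type*} {f : List V → ℤ} (hf : f [] = 0) : mulFun oneFun f = f := by
  funext x
  cases x with
  | nil => simp [mulFun, hf]
  | cons a l =>
    rw [mulFun, Finset.sum_eq_single 0]
    · simp [oneFun]
    · intro i hi h0
      have : ((a :: l).take (i + 1)).length ≠ 1 := by
        have := Finset.mem_range.1 hi
        rw [List.length_take]
        omega
      simp only [oneFun, if_neg this, zero_mul]
    · simp

theorem mulFun_oneFun {V : Type*} {f : List V → ℤ} (hf : f [] = 0) : mulFun f oneFun = f := by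
  funext x
  cases x with
  | nil => simp [mulFun, hf]
  | cons a l =>
    rw [mulFun, Finset.sum_eq_single l.length]
    · have : ((a :: l).drop l.length).length = 1 := by simp
      simp [oneFun, this, -List.length_drop]
    · intro i hi h0
      have : ((a :: l).drop i).length ≠ 1 := by
        have := Finset.mem_range.1 hi
        simp only [List.length_cons, List.length_drop] at this ⊢
        omega
      simp only [oneFun, if_neg this, mul_zero]
    · simp

theorem apply_nil {V : Type*} {G : SimpleGraph V} (f : Cochain G) : f.1 [] = 0 := by
  by_contra h
  exact (f.2.1 _ h).1 rfl

theorem mulFun_add {V : Type*} (f g h : List V → ℤ) :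
    mulFun f (g + h) = mulFun f g + mulFun f h := by
  funext x
  simp [mulFun, mul_add, Finset.sum_add_distrib]

theorem add_mulFun {V : Type*} (f g h : List V → ℤ) :
    mulFun (f + g) h = mulFun f h + mulFun g h := by
  funext x
  simp [mulFun, add_mul, Finset.sum_add_distrib]

/-- The ring of magnitude cochains of `G`. -/
instance {V : Type*} (G : SimpleGraph V) : Ring (Cochain G) :=
  { (inferInstance : AddCommGroup (Cochain G)) with
    mul := fun f g => ⟨mulFun f.1 g.1, mulFun_mem f.2 g.2⟩
    one := ⟨oneFun, oneFun_mem G⟩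
    mul_assoc := fun f g h => Subtype.ext (mulFun_assoc _ _ _)
    one_mul := fun f => Subtype.ext (oneFun_mulFun (apply_nil f))
    mul_one := fun f => Subtype.ext (mulFun_oneFun (apply_nil f))
    zero_mul := fun f => Subtype.ext (show mulFun 0 f.1 = 0 by funext x; simp [mulFun])
    mul_zero := fun f => Subtype.ext (show mulFun f.1 0 = 0 by funext x; simp [mulFun])
    left_distrib := fun f g h => Subtype.ext (mulFun_add _ _ _)
    right_distrib := fun f g h => Subtype.ext (add_mulFun _ _ _) }

theorem coe_mul {V : Type*} {G : SimpleGraph V} (f g : Cochain G) :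
    (f * g : Cochain G).1 = mulFun f.1 g.1 := rfl

theorem coe_one {V : Type*} {G : SimpleGraph V} : (1 : Cochain G).1 = oneFun := rfl

/-- The differential `∂* : MC^k_ℓ → MC^{k+1}_ℓ` on all bidegrees together. -/
noncomputable def d {V : Type*} (G : SimpleGraph V) : Cochain G →+ Cochain G where
  toFun f := ⟨dFun G f.1, dFun_mem f.2⟩
  map_zero' := Subtype.ext (by
    funext x
    simp [dFun])
  map_add' f g := Subtype.ext (by
    funext x
    by_cases hx : IsSimplex x
    · simp only [dFun, AddSubgroup.coe_add, Pi.add_apply, if_pos hx, ← Finset.sum_add_distrib]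
      refine Finset.sum_congr rfl fun i _ => ?_
      split_ifs
      · exact mul_add _ _ _
      · simp
    · simp [dFun, if_neg hx])

theorem d_apply {V : Type*} {G : SimpleGraph V} (f : Cochain G) : (d G f).1 = dFun G f.1 := rfl

/-- The sign automorphism, multiplying cochains of degree `k` by `(-1)^k`. -/
def sgn {V : Type*} {G : SimpleGraph V} (f : Cochain G) : Cochain G :=
  ⟨fun x => (-1) ^ (x.length - 1) * f.1 x,
    fun x hx => f.2.1 x (right_ne_zero_of_mul hx),
    f.2.2.imp fun _ hN x hx => hN x (right_ne_zero_of_mul hx)⟩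

theorem dFun_mulFun {V : Type*} (G : SimpleGraph V) (f g : List V → ℤ) {x : List V}
    (hx : IsSimplex x) :
    dFun G (mulFun f g) x = mulFun (dFun G f) g x +
      mulFun (fun y => (-1) ^ (y.length - 1) * f y) (dFun G g) x := by
  classical
  have h₁ : mulFun (dFun G f) g x = ∑ j ∈ Finset.range x.length, ∑ i ∈ Finset.Ico 1 j,
      if tupleLength G ((x.take (j + 1)).eraseIdx i) = tupleLength G (x.take (j + 1)) then
        (-1) ^ i * f ((x.take (j + 1)).eraseIdx i) * g (x.drop j) else 0 := by
    refine Finset.sum_congr rfl fun j hj => ?_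
    have hj := Finset.mem_range.1 hj
    rw [dFun, if_pos (hx.take j), Finset.sum_mul, List.length_take,
      show min (j + 1) x.length - 1 = j by omega]
    refine Finset.sum_congr rfl fun i _ => ?_
    split_ifs <;> simp
  have h₂ : mulFun (fun y => (-1) ^ (y.length - 1) * f y) (dFun G g) x =
      ∑ j ∈ Finset.range x.length, ∑ i ∈ Finset.Ico 1 (x.length - j - 1),
      if tupleLength G ((x.drop j).eraseIdx i) = tupleLength G (x.drop j) then
        (-1) ^ (j + i) * f (x.take (j + 1)) * g ((x.drop j).eraseIdx i) else 0 := by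
    refine Finset.sum_congr rfl fun j hj => ?_
    have hj := Finset.mem_range.1 hj
    rw [dFun, if_pos (hx.drop hj), Finset.mul_sum]
    beta_reduce
    rw [List.length_take, List.length_drop, show min (j + 1) x.length - 1 = j by omega]
    refine Finset.sum_congr rfl fun i _ => ?_
    split_ifs
    · rw [pow_add]
      ring
    · simp
  have h₀ : dFun G (mulFun f g) x = ∑ i ∈ Finset.Ico 1 (x.length - 1),
      ∑ j ∈ Finset.range (x.length - 1),
      if tupleLength G (x.eraseIdx i) = tupleLength G x then
        (-1) ^ i * f ((x.eraseIdx i).take (j + 1)) * g ((x.eraseIdx i).drop j) else 0 := by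
    rw [dFun, if_pos hx]
    refine Finset.sum_congr rfl fun i hi => ?_
    have hi := Finset.mem_Ico.1 hi
    rw [mulFun, List.length_eraseIdx_of_lt (by omega)]
    split_ifs
    · rw [Finset.mul_sum]
      exact Finset.sum_congr rfl fun j _ => (mul_assoc _ _ _).symm
    · simp
  rw [h₀, h₁, h₂, Finset.sum_sigma', Finset.sum_sigma', Finset.sum_sigma',
    ← Finset.sum_filter_add_sum_filter_not _ (fun p : (_ : ℕ) × ℕ => p.1 ≤ p.2)]
  congr 1
  · refine Finset.sum_bij' (fun p _ => ⟨p.2 + 1, p.1⟩) (fun p _ => ⟨p.2, p.1 - 1⟩) ?_ ?_ ?_ ?_ ?_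
    · rintro ⟨i, j⟩ hp
      simp only [Finset.mem_filter, Finset.mem_sigma, Finset.mem_range, Finset.mem_Ico] at hp ⊢
      omega
    · rintro ⟨i, j⟩ hp
      simp only [Finset.mem_filter, Finset.mem_sigma, Finset.mem_range, Finset.mem_Ico] at hp ⊢
      omega
    · rintro ⟨i, j⟩ hp
      simp
    · rintro ⟨i, j⟩ hp
      simp only [Finset.mem_sigma, Finset.mem_range, Finset.mem_Ico] at hp
      simp only [Sigma.mk.injEq, heq_eq_eq, and_true]
      omega
    · rintro ⟨i, j⟩ hp
      simp only [Finset.mem_filter, Finset.mem_sigma, Finset.mem_range, Finset.mem_Ico] at hp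
      have e₁ : (x.eraseIdx i).take (j + 1) = (x.take (j + 1 + 1)).eraseIdx i := by
        apply List.ext_getElem?
        intro k
        simp only [List.getElem?_take, List.getElem?_eraseIdx]
        split_ifs <;> first | rfl | omega
      have e₂ : (x.eraseIdx i).drop j = x.drop (j + 1) := by
        apply List.ext_getElem?
        intro k
        simp only [List.getElem?_drop, List.getElem?_eraseIdx]
        rw [if_neg (by omega)]
        congr 1
        omega
      have l₁ := tupleLength_split G x (j + 1) (by omega)
      have l₂ := tupleLength_split G (x.eraseIdx i) j
        (by rw [List.length_eraseIdx_of_lt (by omega)]; omega)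
      rw [e₁, e₂] at l₂
      simp only [e₁, e₂]
      refine if_congr ?_ rfl rfl
      omega
  · refine Finset.sum_bij' (fun p _ => ⟨p.2, p.1 - p.2⟩) (fun p _ => ⟨p.1 + p.2, p.1⟩)
      ?_ ?_ ?_ ?_ ?_
    · rintro ⟨i, j⟩ hp
      simp only [Finset.mem_filter, Finset.mem_sigma, Finset.mem_range, Finset.mem_Ico] at hp ⊢
      omega
    · rintro ⟨i, j⟩ hp
      simp only [Finset.mem_filter, Finset.mem_sigma, Finset.mem_range, Finset.mem_Ico] at hp ⊢
      omega
    · rintro ⟨i, j⟩ hp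
      simp only [Finset.mem_filter, Finset.mem_sigma, Finset.mem_range, Finset.mem_Ico] at hp
      simp only [Sigma.mk.injEq, heq_eq_eq, and_true]
      omega
    · rintro ⟨i, j⟩ hp
      simp
    · rintro ⟨i, j⟩ hp
      simp only [Finset.mem_filter, Finset.mem_sigma, Finset.mem_range, Finset.mem_Ico] at hp
      have e₁ : (x.eraseIdx i).take (j + 1) = x.take (j + 1) := by
        apply List.ext_getElem?
        intro k
        simp only [List.getElem?_take, List.getElem?_eraseIdx]
        split_ifs <;> first | rfl | omega
      have e₂ : (x.eraseIdx i).drop j = (x.drop j).eraseIdx (i - j) := by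
        apply List.ext_getElem?
        intro k
        simp only [List.getElem?_drop, List.getElem?_eraseIdx]
        split_ifs <;> first | rfl | omega
      have l₁ := tupleLength_split G x j (by omega)
      have l₂ := tupleLength_split G (x.eraseIdx i) j
        (by rw [List.length_eraseIdx_of_lt (by omega)]; omega)
      rw [e₁, e₂] at l₂
      simp only [e₁, e₂, Nat.add_sub_cancel' (by omega : j ≤ i)]
      refine if_congr ?_ rfl rfl
      omega

theorem isSimplex_of_ne_zero {V : Type*} {G : SimpleGraph V} (f : Cochain G) {x : List V}
    (h : f.1 x ≠ 0) : IsSimplex x :=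
  f.2.1 x h

/-- The Leibniz rule `∂*(φ · ψ) = ∂*φ · ψ + (-1)^{k} φ · ∂*ψ`, where `k` is the degree of `φ`. -/
theorem d_mul {V : Type*} {G : SimpleGraph V} (f g : Cochain G) :
    d G (f * g) = d G f * g + sgn f * d G g := by
  refine Subtype.ext (funext fun x => ?_)
  by_cases hx : IsSimplex x
  · exact dFun_mulFun G f.1 g.1 hx
  · have key : ∀ h : Cochain G, h.1 x = 0 := fun h => by
      by_contra h0
      exact hx (isSimplex_of_ne_zero h h0)
    rw [key, key]

theorem d_sgn {V : Type*} {G : SimpleGraph V} (f : Cochain G) :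
    d G (sgn f) = -sgn (d G f) := by
  refine Subtype.ext (funext fun x => ?_)
  by_cases hx : IsSimplex x
  · change dFun G _ x = -((-1) ^ (x.length - 1) * dFun G f.1 x)
    simp only [dFun, if_pos hx, Finset.mul_sum, ← Finset.sum_neg_distrib]
    refine Finset.sum_congr rfl fun i hi => ?_
    have hi := Finset.mem_Ico.1 hi
    obtain ⟨n, hn⟩ : ∃ n, x.length = n + 2 := ⟨x.length - 2, by omega⟩
    split_ifs
    · simp only [sgn]
      rw [List.length_eraseIdx_of_lt (by omega), hn, show n + 2 - 1 - 1 = n by omega,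
        show n + 2 - 1 = n + 1 by omega]
      ring
    · simp
  · have key : ∀ h : Cochain G, h.1 x = 0 := fun h => by
      by_contra h0
      exact hx (isSimplex_of_ne_zero h h0)
    rw [key, key]

theorem sgn_zero {V : Type*} {G : SimpleGraph V} : sgn (0 : Cochain G) = 0 :=
  Subtype.ext (funext fun _ => mul_zero _)

/-! ### The magnitude cohomology ring -/

/-- The subring of cocycles. -/
def cocycles {V : Type*} (G : SimpleGraph V) : Subring (Cochain G) where
  carrier := {f | d G f = 0}
  zero_mem' := map_zero _
  one_mem' := by
    have key : ∀ x : List V, x.length ≠ 1 → oneFun x = 0 := fun x hx => if_neg hx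
    refine Subtype.ext (funext fun x => ?_)
    change dFun G oneFun x = 0
    unfold dFun
    split_ifs
    · refine Finset.sum_eq_zero fun i hi => ?_
      have hi := Finset.mem_Ico.1 hi
      rw [key _ (by rw [List.length_eraseIdx_of_lt (by omega)]; omega), mul_zero, ite_self]
    · rfl
  add_mem' := fun {f g} (hf : d G f = 0) (hg : d G g = 0) => by
    change d G (f + g) = 0
    rw [map_add, hf, hg, add_zero]
  neg_mem' := fun {f} (hf : d G f = 0) => by
    change d G (-f) = 0
    rw [map_neg, hf, neg_zero]
  mul_mem' := fun {f g} (hf : d G f = 0) (hg : d G g = 0) => by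
    change d G (f * g) = 0
    rw [d_mul, hf, hg, zero_mul, mul_zero, add_zero]

theorem d_eq_zero {V : Type*} {G : SimpleGraph V} (z : cocycles G) : d G z.1 = 0 := z.2

/-- The two-sided ideal of coboundaries in the ring of cocycles. -/
def coboundaries {V : Type*} (G : SimpleGraph V) : Ideal (cocycles G) where
  carrier := {z | ∃ f : Cochain G, d G f = z.1}
  zero_mem' := ⟨0, map_zero _⟩
  add_mem' := by
    rintro z w ⟨f, hf⟩ ⟨g, hg⟩
    exact ⟨f + g, by rw [map_add, hf, hg]; rfl⟩
  smul_mem' := by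
    rintro c z ⟨f, hf⟩
    refine ⟨sgn c.1 * f, ?_⟩
    have hs : sgn (sgn c.1) = c.1 := by
      refine Subtype.ext (funext fun x => ?_)
      simp only [sgn]
      rw [← mul_assoc, ← pow_add, ← two_mul, pow_mul]
      simp
    rw [d_mul, d_sgn, d_eq_zero, sgn_zero, neg_zero, zero_mul, zero_add, hs, hf]
    rfl

instance {V : Type*} (G : SimpleGraph V) : (coboundaries G).IsTwoSided where
  mul_mem_of_left := by
    rintro z w ⟨f, hf⟩
    refine ⟨f * w.1, ?_⟩
    rw [d_mul, d_eq_zero, mul_zero, add_zero, hf]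
    rfl

/-- The magnitude cohomology ring of `G`: cocycles modulo coboundaries. -/
abbrev MH {V : Type*} (G : SimpleGraph V) : Type _ :=
  cocycles G ⧸ coboundaries G

/-- The cocycles of bidegree `(k, ℓ)`. -/
def homogeneousCocycles {V : Type*} (G : SimpleGraph V) (k l : ℕ) : AddSubgroup (cocycles G) where
  carrier := {z | ∀ x, z.1.1 x ≠ 0 → x.length = k + 1 ∧ tupleLength G x = l}
  zero_mem' := fun x h => absurd rfl h
  add_mem' := by
    intro z w hz hw x hx
    by_cases h : z.1.1 x = 0
    · by_cases h' : w.1.1 x = 0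
      · exact absurd (show z.1.1 x + w.1.1 x = 0 by rw [h, h', add_zero]) hx
      · exact hw x h'
    · exact hz x h
  neg_mem' := by
    intro z hz x hx
    exact hz x fun h => hx (show -z.1.1 x = 0 by rw [h, neg_zero])

/-- The group `MH^k_ℓ(G)`, as a subgroup of the magnitude cohomology ring. -/
def MHGraded {V : Type*} (G : SimpleGraph V) (k l : ℕ) : AddSubgroup (MH G) :=
  (homogeneousCocycles G k l).map (Ideal.Quotient.mk (coboundaries G)).toAddMonoidHom

/-- The function `f` on tuples is a cocycle, and `c` is its cohomology class. -/
def IsClassOf {V : Type*} {G : SimpleGraph V} (c : MH G) (f : List V → ℤ) : Prop :=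
  ∃ z : cocycles G, z.1.1 = f ∧ Ideal.Quotient.mk (coboundaries G) z = c

/-! ### The presented ring -/

/-- The vertices `w, x, y, z` of a cycle graph are distinct and in cyclic order, in one of the two
directions around the cycle. -/
def InCyclicOrder {n : ℕ} [NeZero n] (w x y z : Fin n) : Prop :=
  (0 < x - w ∧ x - w < y - w ∧ y - w < z - w) ∨ (0 < w - x ∧ w - x < w - y ∧ w - y < w - z)

/-- The generators: `e x` for vertices `x`, `a x y` for oriented edges `xy`, and `b x z` for ordered
pairs with `d(x, z) = m`, where `x, y, z` are vertices of the cycle graph on `2m + 1` vertices. -/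
inductive Gen (m : ℕ) : Type
  | e (x : Fin (2 * m + 1)) : Gen m
  | a (x y : Fin (2 * m + 1)) (h : (SimpleGraph.cycleGraph (2 * m + 1)).Adj x y) : Gen m
  | b (x z : Fin (2 * m + 1)) (h : (SimpleGraph.cycleGraph (2 * m + 1)).dist x z = m) : Gen m

/-- The bidegree of a generator. -/
def Gen.bidegree {m : ℕ} : Gen m → ℕ × ℕ
  | .e _ => (0, 0)
  | .a _ _ _ => (1, 1)
  | .b _ _ _ => (2, m + 1)

/-- The free associative (non-unital) ring on the generators: integral combinations of nonempty
words. -/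
abbrev FreeRng (m : ℕ) : Type :=
  MonoidAlgebra ℤ (FreeSemigroup (Gen m))

/-- A generator, as an element of the free ring. -/
noncomputable def gen {m : ℕ} (g : Gen m) : FreeRng m :=
  MonoidAlgebra.single (FreeSemigroup.of g) 1

open Gen in
/-- The defining relations. -/
inductive Rel (m : ℕ) : FreeRng m → FreeRng m → Prop
  | e_mul_self (x) : Rel m (gen (e x) * gen (e x)) (gen (e x))
  | e_mul_e (x y) (hxy : x ≠ y) : Rel m (gen (e x) * gen (e y)) 0
  | e_mul_a (x y h) : Rel m (gen (e x) * gen (a x y h)) (gen (a x y h))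
  | a_mul_e (x y h) : Rel m (gen (a x y h) * gen (e y)) (gen (a x y h))
  | e_mul_b (x z h) : Rel m (gen (e x) * gen (b x z h)) (gen (b x z h))
  | b_mul_e (x z h) : Rel m (gen (b x z h) * gen (e z)) (gen (b x z h))
  | a_mul_a (x y z hxy hyz) (hxz : x ≠ z) : Rel m (gen (a x y hxy) * gen (a y z hyz)) 0
  | a_mul_b (w x y z hwx hxz hwy hyz) (hxy : (SimpleGraph.cycleGraph (2 * m + 1)).dist x y = m)
      (hcyc : InCyclicOrder w x y z) :
      Rel m (gen (a w x hwx) * gen (b x z hxz)) (gen (b w y hwy) * gen (a y z hyz))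

/-- The associative ring presented by the generators and relations. -/
abbrev PresentedRing (m : ℕ) : Type :=
  (ringConGen (Rel m)).Quotient

/-- The class of an element of the free ring in the presented ring. -/
noncomputable def toPresented {m : ℕ} (r : FreeRng m) : PresentedRing m :=
  (r : (ringConGen (Rel m)).Quotient)

/-- The bidegree of a word, the sum of the bidegrees of its letters. -/
def wordBidegree {m : ℕ} (w : FreeSemigroup (Gen m)) : ℕ × ℕ :=
  w.head.bidegree + (w.tail.map Gen.bidegree).sum

/-- The part of bidegree `(k, ℓ)` of the presented ring: the subgroup spanned by the words of
bidegree `(k, ℓ)` in the generators. -/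
noncomputable def presentedGraded (m k l : ℕ) : AddSubgroup (PresentedRing m) :=
  AddSubgroup.closure
    {r | ∃ w : FreeSemigroup (Gen m), wordBidegree w = (k, l) ∧
      r = toPresented (MonoidAlgebra.single w 1)}

/-! ### The cochains that represent the generators -/

open Classical in
/-- The cochain dual to the simplex `(x)`. -/
noncomputable def eCochain {V : Type*} (x : V) (s : List V) : ℤ :=
  if s = [x] then 1 else 0

open Classical in
/-- The cochain dual to the simplex `(x, y)`. -/
noncomputable def aCochain {V : Type*} (x y : V) (s : List V) : ℤ :=
  if s = [x, y] then 1 else 0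

open Classical in
/-- The cochain with value `1` on every `2`-simplex `(x, y, z)` of length `l` with the given
endpoints `x` and `z`, and value `0` on all other simplices. -/
noncomputable def bCochain {V : Type*} (G : SimpleGraph V) (l : ℕ) (x z : V) (s : List V) : ℤ :=
  if ∃ y, s = [x, y, z] ∧ IsSimplex s ∧ tupleLength G s = l then 1 else 0

end MagnitudeCohomology

open MagnitudeCohomology

/-!
The magnitude cochain complex of the odd cycle is the cobar complex of a very small ring. A simplex
is a first vertex together with a sequence of steps, each with a direction and a size between `1`
and `m`, and two consecutive steps merge exactly when they have the same direction and total size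
at most `m` (`dFun_path`). So the complex only sees the maximal runs of steps in one direction, and
on each run it is the complex of a truncated polynomial ring `ℤ[t]/(t^{m+1})`, whose cohomology has
the basis `b^j a^ε`. This is why the answer has, apart from the bookkeeping of vertices, just the
relations `a a = 0` and `a b = b a` within one direction and none between the two directions.

The proof makes this explicit with a matching on step sequences. Call a sequence critical if it is
read off from a *normal* word, in which every `a` is followed by a letter of the other direction:
`a` contributes a step of size `1` and `b` the steps of sizes `1`, `m` (`expand`). Every other
sequence has a first place after a critical beginning where either a step of size `k > 1` can be
split as `1, k - 1`, or two steps `1, j` with `j < m` can be merged; this pairs the noncritical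
sequences. Three facts follow.

* Nothing merges in a critical sequence, so coboundaries vanish on it (`del_expand`).
* A cocycle that vanishes on all critical simplices is a coboundary (`exists_d_eq`), by the explicit
  contraction `contract` that belongs to the matching.
* The cochain of a normal word takes the value `1` on its own critical simplex and `0` on all others
  (`wordFun_expand`).

Hence a cohomology class is the same thing as its values on critical simplices (`mkMH_eq_iff`). This
reduces each relation to a comparison of values, and it shows that the classes of the normal words
form a basis. On the other side, the relations rewrite every word as a normal word or zero, so the
normal words span the presented ring (`mem_normalSpan`). The homomorphism from the presented ring to
cohomology therefore sends a spanning set bijectively to a basis, and it is an isomorphism; it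
respects the bidegrees because the critical simplex of a normal word has the bidegree of the word.
-/

namespace MagnitudeCohomology

/-! ### Step sequences and the merging differential -/

/-- A step around the cycle: a direction and a number of edges. -/
abbrev Step : Type := Bool × ℕ

/-- All steps in the list are shortest paths between distinct vertices of the cycle on `2m + 1`
vertices: their sizes lie between `1` and `m`. -/
def Valid (m : ℕ) (L : List Step) : Prop :=
  ∀ a ∈ L, 1 ≤ a.2 ∧ a.2 ≤ m

theorem valid_nil (m : ℕ) : Valid m [] := by simp [Valid]

theorem valid_cons {m : ℕ} {a : Step} {L : List Step} :
    Valid m (a :: L) ↔ (1 ≤ a.2 ∧ a.2 ≤ m) ∧ Valid m L := by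
  simp [Valid]

/-- The contribution to the differential of merging the step `a` with the first step of the list
that follows it. Two steps merge if they have the same direction and the resulting step is still a
shortest path. -/
def headMerge (m : ℕ) (f : List Step → ℤ) (a : Step) : List Step → ℤ
  | [] => 0
  | b :: L => if a.1 = b.1 ∧ a.2 + b.2 ≤ m then -f ((a.1, a.2 + b.2) :: L) else 0

/-- The magnitude differential in terms of step sequences: the alternating sum over all ways to
merge two consecutive steps. -/
def del (m : ℕ) : (List Step → ℤ) → List Step → ℤ
  | _, [] => 0
  | f, a :: L => headMerge m f a L - del m (fun M => f (a :: M)) L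

theorem del_zero (m : ℕ) (L : List Step) : del m (fun _ => 0) L = 0 := by
  induction L with
  | nil => rfl
  | cons a L ih => cases L <;> simp_all [del, headMerge]

theorem del_neg (m : ℕ) (f : List Step → ℤ) (L : List Step) :
    del m (fun M => -f M) L = -del m f L := by
  induction L generalizing f with
  | nil => rfl
  | cons a L ih =>
    rw [del, del, ih]
    cases L with
    | nil => simp [headMerge]
    | cons b L =>
      simp only [headMerge]
      split_ifs <;> ring

theorem del_sub (m : ℕ) (f g : List Step → ℤ) (L : List Step) :
    del m (fun M => f M - g M) L = del m f L - del m g L := by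
  induction L generalizing f g with
  | nil => rfl
  | cons a L ih =>
    rw [del, del, del, ih]
    cases L with
    | nil => simp only [headMerge]; ring
    | cons b L =>
      simp only [headMerge]
      split_ifs <;> ring

theorem del_eq_zero_of_valid {m : ℕ} {f : List Step → ℤ} (hf : ∀ L, Valid m L → f L = 0)
    {L : List Step} (hL : Valid m L) : del m f L = 0 := by
  induction L generalizing f with
  | nil => rfl
  | cons a L ih =>
    obtain ⟨ha, hL⟩ := valid_cons.1 hL
    rw [del, ih (fun M hM => hf _ (valid_cons.2 ⟨ha, hM⟩)) hL, sub_zero]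
    cases L with
    | nil => rfl
    | cons b L =>
      simp only [headMerge]
      split_ifs with h
      · rw [hf _ (valid_cons.2 ⟨⟨by simp only; omega, h.2⟩, (valid_cons.1 hL).2⟩), neg_zero]
      · rfl

/-- Merging steps does not change the direction of the first step. -/
theorem del_congr_head {m : ℕ} {f g : List Step → ℤ} {s : Bool}
    (h : ∀ k L, f ((s, k) :: L) = g ((s, k) :: L)) (k : ℕ) (L : List Step) :
    del m f ((s, k) :: L) = del m g ((s, k) :: L) := by
  rw [del, del]
  congr 1
  · cases L <;> simp [headMerge, h]
  · simp only [h]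

/-- A step cannot merge with a step in the other direction. -/
theorem del_cons_of_ne (m : ℕ) (f : List Step → ℤ) {s t : Bool} (h : s ≠ t) (k j : ℕ)
    (L : List Step) :
    del m f ((s, k) :: (t, j) :: L) = -del m (fun M => f ((s, k) :: M)) ((t, j) :: L) := by
  rw [del]
  simp [headMerge, h]

/-- After a step of size `1`, a step of the maximal size `m` in the same direction merges neither
with that step nor with the one that follows, so such a pair splits off from the differential. -/
theorem del_one_max {m : ℕ} (f : List Step → ℤ) (s : Bool) {L : List Step} (hL : Valid m L) :
    del m f ((s, 1) :: (s, m) :: L) = del m (fun M => f ((s, 1) :: (s, m) :: M)) L := by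
  rw [del, del]
  have h₁ : headMerge m f (s, 1) ((s, m) :: L) = 0 := by simp [headMerge]
  have h₂ : headMerge m (fun M => f ((s, 1) :: M)) (s, m) L = 0 := by
    cases L with
    | nil => rfl
    | cons b L =>
      have := (valid_cons.1 hL).1
      simp only [headMerge]
      rw [if_neg (by omega)]
  rw [h₁, h₂]
  ring

theorem del_one_cons {m : ℕ} (f : List Step → ℤ) (s : Bool) {j : ℕ} (hj : j < m)
    (L : List Step) :
    del m f ((s, 1) :: (s, j) :: L) = -f ((s, j + 1) :: L)
      - headMerge m (fun M => f ((s, 1) :: M)) (s, j) L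
      + del m (fun M => f ((s, 1) :: (s, j) :: M)) L := by
  rw [del, del]
  have h₁ : headMerge m f (s, 1) ((s, j) :: L) = -f ((s, j + 1) :: L) := by
    simp only [headMerge, true_and]
    rw [if_pos (by omega), Nat.add_comm]
  rw [h₁]
  ring

/-! ### Normal words and critical step sequences -/

/-- The letters of the words that span the cohomology ring: the classes `a` and `b`, each in one of
the two directions around the cycle. -/
inductive Letter : Type
  | a (s : Bool) : Letter
  | b (s : Bool) : Letter
deriving DecidableEq

/-- The direction of a letter. -/
def Letter.dir : Letter → Bool
  | .a s => s
  | .b s => s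

/-- The letter `v` may follow the letter `u` in a normal word: an `a` is only followed by letters in
the other direction, since `a a = 0` and `a b = b a` within one direction. -/
def Letter.Precedes (u v : Letter) : Prop :=
  match u with
  | .a s => v.dir ≠ s
  | .b _ => True

/-- The words `b^j a^ε b^j' a^ε' ⋯` in which an `a` is always followed by a letter in the other
direction. -/
def Normal (w : List Letter) : Prop :=
  w.IsChain Letter.Precedes

/-- The critical step sequence of a word, on which its cochain is evaluated: `a` contributes a
step of size `1` and `b` contributes the steps of sizes `1` and `m`. -/
def expand (m : ℕ) : List Letter → List Step
  | [] => []
  | .a s :: w => (s, 1) :: expand m w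
  | .b s :: w => (s, 1) :: (s, m) :: expand m w

theorem Normal.tail {u : Letter} {w : List Letter} (h : Normal (u :: w)) : Normal w :=
  List.IsChain.tail h

theorem Normal.cons_b {w : List Letter} (h : Normal w) (s : Bool) : Normal (.b s :: w) := by
  cases w with
  | nil => simp [Normal]
  | cons v w => exact List.isChain_cons_cons.2 ⟨trivial, h⟩

theorem Normal.cons_a {v : Letter} {w : List Letter} (h : Normal (v :: w)) {s : Bool}
    (hv : v.dir ≠ s) : Normal (.a s :: v :: w) :=
  List.isChain_cons_cons.2 ⟨hv, h⟩

theorem Normal.dir_ne {s : Bool} {v : Letter} {w : List Letter} (h : Normal (.a s :: v :: w)) :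
    v.dir ≠ s :=
  (List.isChain_cons_cons.1 h).1

theorem expand_cons (m : ℕ) (v : Letter) (w : List Letter) :
    ∃ L, expand m (v :: w) = (v.dir, 1) :: L := by
  cases v <;> exact ⟨_, rfl⟩

theorem valid_expand {m : ℕ} (hm : 1 ≤ m) (w : List Letter) : Valid m (expand m w) := by
  induction w with
  | nil => exact valid_nil m
  | cons v w ih => cases v <;> simp [expand, valid_cons, hm, ih]

/-- No two consecutive steps of a critical sequence merge, so all coboundaries vanish on it. -/
theorem del_expand {m : ℕ} (hm : 1 ≤ m) {w : List Letter} (hw : Normal w) (f : List Step → ℤ) :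
    del m f (expand m w) = 0 := by
  induction w generalizing f with
  | nil => rfl
  | cons v w ih =>
    cases v with
    | b s => rw [expand, del_one_max _ _ (valid_expand hm w), ih hw.tail]
    | a s =>
      cases w with
      | nil => simp [expand, del, headMerge]
      | cons v w =>
        obtain ⟨L, hL⟩ := expand_cons m v w
        rw [expand, hL, del_cons_of_ne _ _ hw.dir_ne.symm, ← hL, ih hw.tail, neg_zero]

/-! ### The matching of the remaining step sequences -/

/-- The step sequences that are matched with a shorter one: after a critical beginning they
continue with steps of sizes `1` and `j < m` in the same direction, and merging these two gives the
shorter sequence. -/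
inductive Down (m : ℕ) : List Step → Prop
  | pivot (s : Bool) (j : ℕ) (L : List Step) : 1 ≤ j → j < m → Down m ((s, 1) :: (s, j) :: L)
  | cons_b (s : Bool) (L : List Step) : Down m L → Down m ((s, 1) :: (s, m) :: L)
  | cons_a (s t : Bool) (j : ℕ) (L : List Step) : s ≠ t → Down m ((t, j) :: L) →
      Down m ((s, 1) :: (t, j) :: L)

/-- The contraction given by the matching. The first term comes from splitting a step of size
`k > 1` into steps of sizes `1` and `k - 1`; the other terms correct it along the critical beginning
of the sequence. -/
def contract (m : ℕ) : (List Step → ℤ) → List Step → ℤ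
  | _, [] => 0
  | f, [a] => if 1 < a.2 then -f [(a.1, 1), (a.1, a.2 - 1)] else 0
  | f, a :: b :: L =>
    (if 1 < a.2 then -f ((a.1, 1) :: (a.1, a.2 - 1) :: b :: L) else 0) +
    if a.1 = b.1 then
      if a.2 + b.2 = m + 1 then contract m (fun M => f ((a.1, 1) :: (a.1, m) :: M)) L else 0
    else
      if a.2 = 1 then -contract m (fun M => f ((a.1, 1) :: M)) (b :: L) else 0

theorem contract_one_max (m : ℕ) (f : List Step → ℤ) (s : Bool) (L : List Step) :
    contract m f ((s, 1) :: (s, m) :: L) =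
      contract m (fun M => f ((s, 1) :: (s, m) :: M)) L := by
  rw [contract]
  simp [Nat.add_comm]

theorem contract_one_of_ne (m : ℕ) (f : List Step → ℤ) {s t : Bool} (h : s ≠ t) (k : ℕ)
    (L : List Step) :
    contract m f ((s, 1) :: (t, k) :: L) =
      -contract m (fun M => f ((s, 1) :: M)) ((t, k) :: L) := by
  rw [contract]
  simp [h]

theorem contract_one_cons {m : ℕ} (f : List Step → ℤ) (s : Bool) {j : ℕ} (hj : j ≠ m)
    (L : List Step) : contract m f ((s, 1) :: (s, j) :: L) = 0 := by
  rw [contract]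
  simp only [lt_irrefl, if_false, if_true, zero_add]
  rw [if_neg (by omega)]

/-- On the sequences that are matched with a shorter one, the contraction is a right inverse of the
differential. -/
theorem del_contract {m : ℕ} {L : List Step} (hL : Valid m L) (h : Down m L)
    (f : List Step → ℤ) : del m (contract m f) L = f L := by
  induction h generalizing f with
  | pivot s j L hj hjm =>
    rw [del_one_cons _ _ hjm]
    have h₀ : (fun M => contract m f ((s, 1) :: (s, j) :: M)) = fun _ => 0 :=
      funext fun M => contract_one_cons f s hjm.ne M
    rw [h₀, del_zero, add_zero]
    cases L with
    | nil => simp [headMerge, contract, show 0 < j by omega]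
    | cons b L =>
      obtain ⟨t, k⟩ := b
      rw [contract]
      simp only [headMerge, show 1 < j + 1 by omega, if_true, Nat.add_sub_cancel,
        show j + 1 ≠ 1 by omega, if_false]
      by_cases hst : s = t
      · subst hst
        simp only [if_true, true_and]
        by_cases hk : j + k = m
        · subst hk
          rw [if_pos le_rfl, if_pos (by omega), contract_one_max]
          ring
        · rw [contract_one_cons f s hk, if_neg (by omega)]
          simp
      · simp [hst]
  | cons_b s L _ ih =>
    have hL := (valid_cons.1 (valid_cons.1 hL).2).2
    rw [del_one_max _ _ hL]
    simp only [contract_one_max]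
    exact ih hL _
  | cons_a s t j L hst _ ih =>
    rw [del_cons_of_ne _ _ hst, del_congr_head
      (g := fun M => -contract m (fun M => f ((s, 1) :: M)) M)
      (fun k L => contract_one_of_ne m f hst k L), del_neg, neg_neg]
    exact ih (valid_cons.1 hL).2 _

/-- A cocycle on the step sequences that begin in the directions in `S` is zero if it vanishes on
critical sequences and on those matched with a shorter one. The set `S` is there for the induction:
after a step of size `1` that is critical by itself, the sequence continues in the other
direction. -/
theorem eq_zero_of_del_eq_zero {m : ℕ} (hm : 1 ≤ m) (N : ℕ) (S : Set Bool) (f : List Step → ℤ)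
    (hf : ∀ s ∈ S, ∀ k L, Valid m ((s, k) :: L) → del m f ((s, k) :: L) = 0)
    (hcrit : ∀ w, Normal w → (∀ v ∈ w.head?, v.dir ∈ S) → f (expand m w) = 0)
    (hdown : ∀ s ∈ S, ∀ k L, Valid m ((s, k) :: L) → Down m ((s, k) :: L) → f ((s, k) :: L) = 0)
    (L : List Step) (hL : Valid m L) (hS : ∀ a ∈ L.head?, a.1 ∈ S) (hN : L.length ≤ N) :
    f L = 0 := by
  induction N generalizing S f L with
  | zero =>
    obtain rfl : L = [] := List.length_eq_zero_iff.1 (by omega)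
    exact hcrit [] (by simp [Normal]) (by simp)
  | succ N ih =>
    have key : ∀ s ∈ S, ∀ L, Valid m L → L.length ≤ N → f ((s, 1) :: (s, m) :: L) = 0 := by
      intro s hs L hL hN
      have hv : ∀ L, Valid m L → Valid m ((s, 1) :: (s, m) :: L) := fun L hL => by
        simp [valid_cons, hL, hm]
      refine ih Set.univ (fun M => f ((s, 1) :: (s, m) :: M)) ?_ ?_ ?_ L hL (by simp) hN
      · intro t _ k M hM
        rw [← del_one_max _ _ hM]
        exact hf s hs _ _ (hv _ hM)
      · intro w hw _
        exact hcrit (.b s :: w) (hw.cons_b s) (by simpa [Letter.dir] using hs)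
      · intro t _ k M hM hd
        exact hdown s hs _ _ (hv _ hM) (.cons_b _ _ hd)
    match L with
    | [] => exact hcrit [] (by simp [Normal]) (by simp)
    | (s, k) :: Q =>
      have hs : s ∈ S := by simpa using hS
      obtain ⟨hk, hQ⟩ := valid_cons.1 hL
      simp only at hk
      rcases Nat.lt_or_ge 1 k with h1 | h1
      · obtain ⟨j, rfl⟩ : ∃ j, k = j + 1 := ⟨k - 1, by omega⟩
        have hv : ∀ M, Valid m M → Valid m ((s, 1) :: (s, j) :: M) := fun M hM => by
          simp only [valid_cons]
          exact ⟨by omega, by omega, hM⟩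
        -- The sequence is matched with the one obtained by splitting off a step of size `1`. Among
        -- the terms of the cocycle condition there, all but `f` of the sequence itself vanish.
        have h₀ := hf s hs _ _ (hv _ hQ)
        have hz : ∀ M, Valid m M → f ((s, 1) :: (s, j) :: M) = 0 := fun M hM =>
          hdown s hs _ _ (hv _ hM) (.pivot s j M (by omega) (by omega))
        rw [del_one_cons _ _ (by omega)] at h₀
        have hmerge : headMerge m (fun M => f ((s, 1) :: M)) (s, j) Q = 0 := by
          match Q with
          | [] => rfl
          | (t, i) :: Q =>
            obtain ⟨hi, hQ⟩ := valid_cons.1 hQ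
            simp only at hi
            simp only [headMerge]
            split_ifs with h
            · rcases h.2.lt_or_eq with hlt | heq
              · rw [hdown s hs _ _ _ (.pivot s _ Q (by omega) hlt), neg_zero]
                simp only [valid_cons]
                exact ⟨by omega, by omega, hQ⟩
              · rw [heq, key s hs Q hQ (by simp at hN; omega), neg_zero]
            · rfl
        rw [hmerge, del_eq_zero_of_valid hz hQ] at h₀
        omega
      · obtain rfl : k = 1 := by omega
        match Q with
        | [] => exact hcrit [.a s] (by simp [Normal]) (by simpa [Letter.dir] using hs)
        | (t, j) :: Q =>
          have hj := (valid_cons.1 hQ).1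
          simp only at hj
          by_cases hst : s = t
          · subst hst
            by_cases hjm : j = m
            · subst hjm
              exact key s hs Q (valid_cons.1 hQ).2 (by simp at hN; omega)
            · exact hdown s hs _ _ hL (.pivot s j Q hj.1 (by omega))
          · refine ih {t} (fun M => f ((s, 1) :: M)) ?_ ?_ ?_ _ hQ (by simp)
              (by simpa using hN)
            · rintro _ rfl k M hM
              have := hf s hs 1 _ (valid_cons.2 ⟨⟨le_rfl, hm⟩, hM⟩)
              rw [del_cons_of_ne _ _ hst] at this
              exact neg_eq_zero.1 this
            · intro w hw hwt
              refine hcrit (.a s :: w) ?_ (by simpa [Letter.dir] using hs)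
              cases w with
              | nil => simp [Normal]
              | cons v w =>
                have : v.dir = t := by simpa using hwt
                exact hw.cons_a (by rw [this]; exact Ne.symm hst)
            · rintro _ rfl k M hM hd
              exact hdown s hs _ _ (valid_cons.2 ⟨⟨le_rfl, hm⟩, hM⟩) (.cons_a _ _ _ _ hst hd)

/-- The total length of a step sequence. -/
def totalSize (L : List Step) : ℕ :=
  (L.map Prod.snd).sum

theorem totalSize_cons (a : Step) (L : List Step) : totalSize (a :: L) = a.2 + totalSize L := by
  simp [totalSize]

theorem exists_of_split_ne_zero {m : ℕ} {f : List Step → ℤ} {a : Step} {L : List Step}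
    (hL : Valid m (a :: L))
    (h : (if 1 < a.2 then -f ((a.1, 1) :: (a.1, a.2 - 1) :: L) else 0) ≠ 0) :
    ∃ L', Valid m L' ∧ f L' ≠ 0 ∧ L'.length = (a :: L).length + 1 ∧
      totalSize L' = totalSize (a :: L) := by
  obtain ⟨ha, hL⟩ := valid_cons.1 hL
  split_ifs at h with h1
  · refine ⟨_, ?_, neg_ne_zero.1 h, by simp, ?_⟩
    · simp only [valid_cons]
      exact ⟨by omega, by omega, hL⟩
    · simp only [totalSize_cons]
      omega
  · exact absurd rfl h

/-- The contraction lowers the degree by one and preserves the length. -/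
theorem exists_of_contract_ne_zero {m : ℕ} (f : List Step → ℤ) (L : List Step) (hL : Valid m L)
    (h : contract m f L ≠ 0) :
    ∃ L', Valid m L' ∧ f L' ≠ 0 ∧ L'.length = L.length + 1 ∧ totalSize L' = totalSize L := by
  match L with
  | [] => exact absurd rfl h
  | [a] =>
    rw [contract] at h
    exact exists_of_split_ne_zero hL h
  | a :: b :: L =>
    rw [contract] at h
    obtain ⟨ha, hQ⟩ := valid_cons.1 hL
    by_cases h₀ : (if 1 < a.2 then -f ((a.1, 1) :: (a.1, a.2 - 1) :: b :: L) else 0) = 0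
    · rw [h₀, zero_add] at h
      split_ifs at h with h₁ h₂ h₂
      · obtain ⟨L', hv, hf, hl, ht⟩ := exists_of_contract_ne_zero _ L (valid_cons.1 hQ).2 h
        refine ⟨_, ?_, hf, by simp [hl], ?_⟩
        · simp only [valid_cons]
          exact ⟨by omega, by omega, hv⟩
        · simp only [totalSize_cons]
          omega
      · exact absurd rfl h
      · obtain ⟨L', hv, hf, hl, ht⟩ := exists_of_contract_ne_zero _ _ hQ (neg_ne_zero.1 h)
        refine ⟨_, ?_, hf, by simp [hl], ?_⟩
        · simp only [valid_cons]
          exact ⟨by omega, hv⟩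
        · simp only [totalSize_cons] at ht ⊢
          omega
      · exact absurd rfl h
    · exact exists_of_split_ne_zero hL h₀

/-! ### Distances in an odd cycle -/

open SimpleGraph

/-- The shorter way around the cycle from `0` to `c` grows by at most one when `c` does. -/
theorem min_val_neg_add_one_le {n : ℕ} (c : Fin (n + 1)) :
    min (c + 1).val (-(c + 1)).val ≤ min c.val (-c).val + 1 := by
  rw [Fin.val_neg, Fin.val_neg, Fin.val_add_one]
  have := c.isLt
  have h0 : c = 0 ↔ c.val = 0 := Fin.ext_iff
  have hl : c = Fin.last n ↔ c.val = n := Fin.ext_iff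
  have h1 : c + 1 = 0 → c = Fin.last n := by
    intro h
    by_contra hc
    have := congrArg Fin.val h
    rw [Fin.val_add_one, if_neg hc] at this
    simp at this
  split_ifs <;> grind

/-- The distance in a cycle is the shorter of the two ways around it. -/
theorem dist_cycleGraph (n : ℕ) (x y : Fin (n + 1)) :
    (cycleGraph (n + 1)).dist x y = min (y - x).val (x - y).val := by
  have upper : ∀ (k : ℕ) (x : Fin (n + 1)),
      (cycleGraph (n + 1)).dist x (x + Fin.ofNat _ k) ≤ k := by
    intro k x
    induction k with
    | zero => simp
    | succ k ih =>
      have h₁ : x + Fin.ofNat (n + 1) (k + 1) = x + Fin.ofNat _ k + 1 := by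
        rw [add_assoc]
        congr 1
        ext
        simp [Fin.val_add]
      have h₂ : ∀ y : Fin (n + 1), (cycleGraph (n + 1)).dist y (y + 1) ≤ 1 := by
        intro y
        cases n with
        | zero => rw [show y + 1 = y from Fin.ext (by omega)]; simp
        | succ n => exact (dist_eq_one_iff_adj.2 (cycleGraph_adj.2 (by simp))).le
      rw [h₁]
      exact (cycleGraph_connected.dist_triangle).trans (Nat.add_le_add ih (h₂ _))
  have lower : ∀ {x y : Fin (n + 1)} (p : (cycleGraph (n + 1)).Walk x y),
      min (y - x).val (x - y).val ≤ p.length := by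
    intro x y p
    have one : ∀ {c : Fin (n + 1)}, c.val = 1 → c = 1 := by
      intro c hc
      have := c.isLt
      ext
      rw [hc]
      exact (Nat.mod_eq_of_lt (by omega)).symm
    induction p with
    | nil => simp
    | @cons u v w h p ih =>
      rw [Walk.length_cons]
      rcases cycleGraph_adj'.1 h with h | h
      · have h₁ : u - w = v - w + 1 := by rw [← one h]; abel
        have := min_val_neg_add_one_le (v - w)
        rw [← h₁, neg_sub, neg_sub, min_comm, min_comm (v - w).val] at this
        omega
      · have h₁ : w - u = w - v + 1 := by rw [← one h]; abel
        have := min_val_neg_add_one_le (w - v)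
        rw [← h₁, neg_sub, neg_sub] at this
        omega
  have close : ∀ x y : Fin (n + 1), (cycleGraph (n + 1)).dist x y ≤ (y - x).val := by
    intro x y
    simpa using upper (y - x).val x
  refine le_antisymm (le_min (close x y) ?_) ?_
  · rw [SimpleGraph.dist_comm]
    exact close y x
  · obtain ⟨p, hp⟩ := cycleGraph_connected.exists_walk_length_eq_dist x y
    rw [← hp]
    exact lower p

/-- The vertex reached from `x` by the step `a`. -/
def move {m : ℕ} (x : Fin (2 * m + 1)) (a : Step) : Fin (2 * m + 1) :=
  if a.1 then x + Fin.ofNat _ a.2 else x - Fin.ofNat _ a.2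

/-- The tuple of vertices visited by a step sequence that starts at `x`. -/
def path {m : ℕ} (x : Fin (2 * m + 1)) : List Step → List (Fin (2 * m + 1))
  | [] => [x]
  | a :: L => x :: path (move x a) L

theorem move_move {m : ℕ} (x : Fin (2 * m + 1)) (s : Bool) (j k : ℕ) :
    move (move x (s, j)) (s, k) = move x (s, j + k) := by
  have : (Fin.ofNat (2 * m + 1) (j + k)) = Fin.ofNat _ j + Fin.ofNat _ k := by
    ext; simp [Fin.val_add]
  cases s <;> simp only [move, this]
  · simp only [Bool.false_eq_true, if_false]; abel
  · simp only [if_true]; abel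

theorem move_move_not {m : ℕ} (x : Fin (2 * m + 1)) (s : Bool) (k : ℕ) :
    move (move x (s, k)) (!s, k) = x := by
  cases s <;> simp [move]

/-- The two ways around the cycle to the same vertex have total size `2m + 1`. -/
theorem move_not {m : ℕ} (x : Fin (2 * m + 1)) (s : Bool) {j k : ℕ} (h : j + k = 2 * m + 1) :
    move x (!s, j) = move x (s, k) := by
  have h₀ : Fin.ofNat (2 * m + 1) j + Fin.ofNat _ k = 0 := by
    ext
    simp [Fin.val_add, h]
  cases s
  · simp only [move, Bool.not_false, if_true, Bool.false_eq_true, if_false]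
    rw [eq_sub_iff_add_eq, add_assoc, h₀, add_zero]
  · simp only [move, Bool.not_true, if_true, Bool.false_eq_true, if_false]
    rw [sub_eq_iff_eq_add, add_assoc, add_comm (Fin.ofNat _ k), h₀, add_zero]

theorem dist_move {m : ℕ} (x : Fin (2 * m + 1)) {a : Step} (ha : a.2 ≤ 2 * m + 1) :
    (cycleGraph (2 * m + 1)).dist x (move x a) = min a.2 (2 * m + 1 - a.2) := by
  obtain ⟨s, k⟩ := a
  have h₀ : ∀ c : Fin (2 * m + 1), c = Fin.ofNat _ k →
      min c.val (-c).val = min k (2 * m + 1 - k) := by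
    rintro c rfl
    rw [Fin.val_neg]
    rcases (Nat.lt_or_eq_of_le ha) with h | h
    · have : (Fin.ofNat (2 * m + 1) k).val = k := Nat.mod_eq_of_lt h
      rw [this]
      split_ifs with hc
      · have : k = 0 := by rw [← this, hc]; rfl
        omega
      · rfl
    · have h : k = 2 * m + 1 := h
      subst h
      simp
  rw [dist_cycleGraph]
  cases s
  · simpa [move, min_comm] using h₀ _ rfl
  · simpa [move] using h₀ _ rfl

/-- Two shortest steps make up a shortest path exactly when they can be merged: steps in the same
direction of total size above `m` have a shortcut the other way around. -/
theorem dist_move_move {m : ℕ} (x : Fin (2 * m + 1)) {a b : Step} (ha : 1 ≤ a.2 ∧ a.2 ≤ m)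
    (hb : 1 ≤ b.2 ∧ b.2 ≤ m) :
    (cycleGraph (2 * m + 1)).dist x (move (move x a) b) = a.2 + b.2 ↔
      a.1 = b.1 ∧ a.2 + b.2 ≤ m := by
  obtain ⟨s, i⟩ := a
  obtain ⟨t, j⟩ := b
  simp only at ha hb ⊢
  by_cases hst : s = t
  · subst hst
    rw [move_move, dist_move _ (by simp only; omega)]
    simp only [true_and]
    omega
  · obtain rfl : t = !s := by cases s <;> cases t <;> simp_all
    simp only [hst, false_and, iff_false]
    rcases Nat.le_total j i with h | h
    · obtain ⟨k, rfl⟩ := Nat.exists_eq_add_of_le' h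
      rw [← move_move, move_move_not, dist_move _ (by simp only; omega)]
      simp only
      omega
    · obtain ⟨k, rfl⟩ := Nat.exists_eq_add_of_le h
      rw [← move_move _ (!s), move_move_not, dist_move _ (by simp only; omega)]
      simp only
      omega

/-- The shortest step from `x` to `y`. -/
def stepTo {m : ℕ} (x y : Fin (2 * m + 1)) : Step :=
  if (y - x).val ≤ m then (true, (y - x).val) else (false, (x - y).val)

theorem move_stepTo {m : ℕ} (x y : Fin (2 * m + 1)) : move x (stepTo x y) = y := by
  unfold stepTo
  split_ifs <;> simp [move]

theorem stepTo_size {m : ℕ} {x y : Fin (2 * m + 1)} (h : x ≠ y) :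
    1 ≤ (stepTo x y).2 ∧ (stepTo x y).2 ≤ m := by
  have h₀ : y - x ≠ 0 := sub_ne_zero.2 h.symm
  have h₁ : (y - x).val ≠ 0 := fun h => h₀ (Fin.ext h)
  have h₂ : (x - y).val = 2 * m + 1 - (y - x).val := by
    rw [← neg_sub, Fin.val_neg, if_neg h₀]
  have := (y - x).isLt
  unfold stepTo
  split_ifs <;> simp only <;> omega

theorem stepTo_move {m : ℕ} (x : Fin (2 * m + 1)) {a : Step} (ha : 1 ≤ a.2 ∧ a.2 ≤ m) :
    stepTo x (move x a) = a := by
  obtain ⟨s, k⟩ := a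
  simp only at ha
  have h₀ : (Fin.ofNat (2 * m + 1) k).val = k := Nat.mod_eq_of_lt (by omega)
  have h₁ : (-Fin.ofNat (2 * m + 1) k).val = 2 * m + 1 - k := by
    rw [Fin.val_neg, h₀, if_neg]
    intro h
    rw [h] at h₀
    simp at h₀
    omega
  cases s
  · have h₂ : x - Fin.ofNat _ k - x = -Fin.ofNat _ k := by abel
    have h₃ : x - (x - Fin.ofNat _ k) = Fin.ofNat _ k := by abel
    simp only [stepTo, move, Bool.false_eq_true, if_false, h₂, h₁, h₃, h₀]
    rw [if_neg (by omega)]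
  · have h₂ : x + Fin.ofNat _ k - x = Fin.ofNat _ k := by abel
    simp only [stepTo, move, if_true, h₂, h₀]
    rw [if_pos ha.2]

theorem ne_move {m : ℕ} (x : Fin (2 * m + 1)) {a : Step} (ha : 1 ≤ a.2 ∧ a.2 ≤ m) :
    x ≠ move x a := by
  intro h
  have := stepTo_move x ha
  rw [← h] at this
  rw [← this] at ha
  simp [stepTo] at ha

/-! ### Simplices as step sequences -/

theorem path_eq_cons {m : ℕ} (x : Fin (2 * m + 1)) (L : List Step) :
    ∃ l, path x L = x :: l := by
  cases L <;> exact ⟨_, rfl⟩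

theorem length_path {m : ℕ} (x : Fin (2 * m + 1)) (L : List Step) :
    (path x L).length = L.length + 1 := by
  induction L generalizing x with
  | nil => rfl
  | cons a L ih => simp [path, ih]

theorem isSimplex_path {m : ℕ} (x : Fin (2 * m + 1)) {L : List Step} (hL : Valid m L) :
    IsSimplex (path x L) := by
  induction L generalizing x with
  | nil => exact ⟨by simp [path], by simp [path]⟩
  | cons a L ih =>
    obtain ⟨ha, hL⟩ := valid_cons.1 hL
    have := ih (move x a) hL
    obtain ⟨l, hl⟩ := path_eq_cons (move x a) L
    rw [hl] at this
    rw [path, hl]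
    exact ⟨by simp, List.isChain_cons_cons.2 ⟨ne_move x ha, this.2⟩⟩

theorem tupleLength_path {m : ℕ} (x : Fin (2 * m + 1)) {L : List Step} (hL : Valid m L) :
    tupleLength (cycleGraph (2 * m + 1)) (path x L) = totalSize L := by
  induction L generalizing x with
  | nil => rfl
  | cons a L ih =>
    obtain ⟨ha, hL⟩ := valid_cons.1 hL
    have := ih (move x a) hL
    obtain ⟨l, hl⟩ := path_eq_cons (move x a) L
    rw [path, totalSize_cons, ← this, hl, tupleLength, dist_move _ (by omega)]
    omega

/-- The step sequence of a tuple of vertices. -/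
def steps {m : ℕ} : List (Fin (2 * m + 1)) → List Step
  | [] => []
  | [_] => []
  | x :: y :: l => stepTo x y :: steps (y :: l)

theorem steps_path {m : ℕ} (x : Fin (2 * m + 1)) {L : List Step} (hL : Valid m L) :
    steps (path x L) = L := by
  induction L generalizing x with
  | nil => rfl
  | cons a L ih =>
    obtain ⟨ha, hL⟩ := valid_cons.1 hL
    have := ih (move x a) hL
    obtain ⟨l, hl⟩ := path_eq_cons (move x a) L
    rw [path, hl, steps, ← hl, this, stepTo_move x ha]

theorem path_steps {m : ℕ} (x : Fin (2 * m + 1)) (l : List (Fin (2 * m + 1))) :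
    path x (steps (x :: l)) = x :: l := by
  induction l generalizing x with
  | nil => rfl
  | cons y l ih => rw [steps, path, move_stepTo, ih]

theorem valid_steps {m : ℕ} {l : List (Fin (2 * m + 1))} (hl : IsSimplex l) :
    Valid m (steps l) := by
  induction l with
  | nil => exact valid_nil m
  | cons x l ih =>
    cases l with
    | nil => exact valid_nil m
    | cons y l =>
      obtain ⟨h₁, h₂⟩ := List.isChain_cons_cons.1 hl.2
      exact valid_cons.2 ⟨stepTo_size h₁, ih ⟨by simp, h₂⟩⟩

theorem IsSimplex.exists_path {m : ℕ} {l : List (Fin (2 * m + 1))} (hl : IsSimplex l) :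
    ∃ x L, Valid m L ∧ path x L = l := by
  cases l with
  | nil => exact absurd rfl hl.1
  | cons x l => exact ⟨x, steps (x :: l), valid_steps hl, path_steps x l⟩

/-- The magnitude differential splits into the term that omits the second vertex and the
differential of the tuple without its first vertex. -/
theorem dFun_cons_cons {V : Type*} (G : SimpleGraph V) (f : List V → ℤ) {x y z : V} {l : List V}
    (h : IsSimplex (x :: y :: z :: l)) [Decidable (G.dist x z = G.dist x y + G.dist y z)] :
    dFun G f (x :: y :: z :: l) =
      (if G.dist x z = G.dist x y + G.dist y z then -f (x :: z :: l) else 0)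
        - dFun G (fun t => f (x :: t)) (y :: z :: l) := by
  classical
  have h' : IsSimplex (y :: z :: l) := ⟨by simp, (List.isChain_cons_cons.1 h.2).2⟩
  rw [dFun, dFun, if_pos h, if_pos h']
  simp only [List.length_cons, Nat.add_sub_cancel]
  rw [Finset.sum_eq_sum_Ico_succ_bot (by omega), sub_eq_add_neg]
  congr 1
  · simp [tupleLength, ← add_assoc]
  · rw [← Finset.sum_Ico_add' _ 1 (l.length + 1) 1, ← Finset.sum_neg_distrib]
    refine Finset.sum_congr rfl fun i hi => ?_
    obtain ⟨i, rfl⟩ : ∃ j, i = j + 1 := ⟨i - 1, by have := Finset.mem_Ico.1 hi; omega⟩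
    have e₁ : (x :: y :: z :: l).eraseIdx (i + 1 + 1) = x :: y :: (z :: l).eraseIdx i := by simp
    have e₂ : (y :: z :: l).eraseIdx (i + 1) = y :: (z :: l).eraseIdx i := by simp
    have e₃ : tupleLength G (x :: y :: (z :: l).eraseIdx i) = tupleLength G (x :: y :: z :: l) ↔
        tupleLength G (y :: (z :: l).eraseIdx i) = tupleLength G (y :: z :: l) := by
      simp only [tupleLength, Nat.add_left_cancel_iff]
    simp only [e₁, e₂, e₃]
    split_ifs
    · ring
    · exact neg_zero.symm

theorem dFun_of_length_le_two {V : Type*} (G : SimpleGraph V) (f : List V → ℤ) {x : List V}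
    (h : x.length ≤ 2) : dFun G f x = 0 := by
  rw [dFun, Finset.Ico_eq_empty (by omega)]
  simp only [Finset.sum_empty]
  exact ite_self _

/-- On tuples in the cycle the magnitude differential is the merging differential. -/
theorem dFun_path {m : ℕ} (f : List (Fin (2 * m + 1)) → ℤ) (x : Fin (2 * m + 1)) {L : List Step}
    (hL : Valid m L) :
    dFun (cycleGraph (2 * m + 1)) f (path x L) = del m (fun M => f (path x M)) L := by
  induction L generalizing f x with
  | nil => exact dFun_of_length_le_two _ _ (by simp [path])
  | cons a L ih =>
    have hs := isSimplex_path x hL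
    obtain ⟨ha, hL⟩ := valid_cons.1 hL
    rw [del]
    have := ih (fun t => f (x :: t)) (move x a) hL
    simp only [path]
    rw [← this]
    cases L with
    | nil => simp [path, dFun_of_length_le_two, headMerge]
    | cons b L =>
      obtain ⟨hb, -⟩ := valid_cons.1 hL
      obtain ⟨l, hl⟩ := path_eq_cons (move (move x a) b) L
      have hd := dist_move_move x ha hb
      simp only [path, hl] at hs ⊢
      rw [dFun_cons_cons _ _ hs]
      congr 1
      rw [dist_move x (by omega), dist_move (move x a) (by omega), min_eq_left (by omega),
        min_eq_left (by omega)]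
      simp only [headMerge, hd]
      refine if_ctx_congr Iff.rfl (fun h => ?_) fun _ => rfl
      obtain ⟨s, i⟩ := a
      obtain ⟨t, j⟩ := b
      obtain rfl : s = t := h.1
      rw [path, ← move_move, hl]

/-- The cycle with `2m + 1` vertices. -/
abbrev oddCycle (m : ℕ) : SimpleGraph (Fin (2 * m + 1)) :=
  SimpleGraph.cycleGraph (2 * m + 1)

/-! ### The coboundary criterion -/

theorem del_headMerge_cons (m : ℕ) (f : List Step → ℤ) (a b : Step) (L : List Step) :
    del m (fun K => headMerge m f a (b :: K)) L =
      if a.1 = b.1 ∧ a.2 + b.2 ≤ m then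
        -del m (fun K => f ((a.1, a.2 + b.2) :: K)) L else 0 := by
  simp only [headMerge]
  split_ifs
  · exact del_neg _ _ _
  · exact del_zero _ _

/-- Two merges in either order cancel: among three consecutive steps both orders are possible under
the same condition on the total size. -/
theorem del_del (m : ℕ) (f : List Step → ℤ) (L : List Step) : del m (del m f) L = 0 := by
  induction L generalizing f with
  | nil => rfl
  | cons a L ih =>
    have h₁ : (fun M => del m f (a :: M)) =
        fun M => headMerge m f a M - del m (fun K => f (a :: K)) M := rfl
    rw [del, h₁, del_sub, ih, sub_zero]
    cases L with
    | nil => rfl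
    | cons b L =>
      rw [del, del_headMerge_cons]
      cases L with
      | nil => simp [headMerge, del]
      | cons c L =>
        obtain ⟨s, i⟩ := a
        obtain ⟨t, j⟩ := b
        obtain ⟨u, k⟩ := c
        simp only [headMerge, del]
        by_cases h₁ : s = t
        · by_cases h₂ : t = u
          · subst h₁ h₂
            simp only [true_and]
            by_cases h₃ : i + j + k ≤ m
            · rw [if_pos (by omega), if_pos (by omega), if_pos (by omega), if_pos (by omega),
                if_pos (by omega), Nat.add_assoc]
              ring
            · rw [if_neg h₃, if_neg (by omega : ¬ i + (j + k) ≤ m)]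
              split_ifs <;> ring
          · subst h₁
            simp only [h₂, false_and, if_false]
            split_ifs <;> ring
        · simp [h₁]

theorem del_congr_valid {m : ℕ} {f g : List Step → ℤ} (h : ∀ L, Valid m L → f L = g L)
    {L : List Step} (hL : Valid m L) : del m f L = del m g L := by
  rw [← sub_eq_zero, ← del_sub]
  exact del_eq_zero_of_valid (fun M hM => sub_eq_zero.2 (h M hM)) hL

theorem Cochain.ext_path {m : ℕ} {f g : Cochain (oddCycle m)}
    (h : ∀ x L, Valid m L → f.1 (path x L) = g.1 (path x L)) : f = g := by
  refine Subtype.ext (funext fun l => ?_)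
  by_cases hl : IsSimplex l
  · obtain ⟨x, L, hL, rfl⟩ := hl.exists_path
    exact h x L hL
  · have key : ∀ f : Cochain (oddCycle m), f.1 l = 0 := fun f => by
      by_contra h0
      exact hl (isSimplex_of_ne_zero f h0)
    rw [key, key]

theorem d_path {m : ℕ} (f : Cochain (oddCycle m)) (x : Fin (2 * m + 1)) {L : List Step}
    (hL : Valid m L) : (d (oddCycle m) f).1 (path x L) = del m (fun M => f.1 (path x M)) L :=
  dFun_path f.1 x hL

theorem d_eq_zero_of_del {m : ℕ} {f : Cochain (oddCycle m)}
    (h : ∀ x L, Valid m L → del m (fun M => f.1 (path x M)) L = 0) : d (oddCycle m) f = 0 :=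
  Cochain.ext_path fun x L hL => (d_path f x hL).trans (h x L hL)

theorem del_eq_zero_of_d {m : ℕ} {f : Cochain (oddCycle m)} (hf : d (oddCycle m) f = 0)
    (x : Fin (2 * m + 1)) {L : List Step} (hL : Valid m L) :
    del m (fun M => f.1 (path x M)) L = 0 := by
  rw [← d_path f x hL, hf]
  rfl

open Classical in
/-- The contraction of a cochain, starting from the first vertex of each simplex. -/
noncomputable def contractFun {m : ℕ} (f : List (Fin (2 * m + 1)) → ℤ)
    (l : List (Fin (2 * m + 1))) : ℤ :=
  if IsSimplex l then contract m (fun M => f (path (l.headD 0) M)) (steps l) else 0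

theorem contractFun_path {m : ℕ} (f : List (Fin (2 * m + 1)) → ℤ) (x : Fin (2 * m + 1))
    {L : List Step} (hL : Valid m L) :
    contractFun f (path x L) = contract m (fun M => f (path x M)) L := by
  rw [contractFun, if_pos (isSimplex_path x hL), steps_path x hL]
  cases L <;> rfl

theorem contractFun_mem {m : ℕ} (f : Cochain (oddCycle m)) :
    contractFun f.1 ∈ Cochain (oddCycle m) := by
  obtain ⟨N, hN⟩ := f.2.2
  have hs : ∀ l, contractFun f.1 l ≠ 0 → IsSimplex l := fun l hl => by
    by_contra h
    exact hl (if_neg h)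
  refine ⟨hs, N, fun l hl => ?_⟩
  obtain ⟨x, L, hL, rfl⟩ := (hs l hl).exists_path
  rw [contractFun_path _ _ hL] at hl
  obtain ⟨L', hv, hf, hlen, hsize⟩ := exists_of_contract_ne_zero _ L hL hl
  have := hN _ hf
  rw [length_path, tupleLength_path _ hv] at this
  rw [length_path, tupleLength_path _ hL]
  omega

/-- A cocycle that vanishes on all critical simplices is a coboundary. -/
theorem exists_d_eq {m : ℕ} (hm : 1 ≤ m) {f : Cochain (oddCycle m)} (hf : d (oddCycle m) f = 0)
    (h : ∀ x w, Normal w → f.1 (path x (expand m w)) = 0) :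
    ∃ g, d (oddCycle m) g = f := by
  refine ⟨⟨contractFun f.1, contractFun_mem f⟩, Cochain.ext_path fun x L hL => ?_⟩
  rw [d_path _ _ hL, ← sub_eq_zero]
  have hc : ∀ L, Valid m L → del m (fun M => contractFun f.1 (path x M)) L =
      del m (contract m fun M => f.1 (path x M)) L := by
    intro L hL
    exact del_congr_valid (fun M hM => contractFun_path _ _ hM) hL
  rw [hc L hL]
  refine eq_zero_of_del_eq_zero hm L.length Set.univ
    (fun M => del m (contract m fun M => f.1 (path x M)) M - f.1 (path x M)) ?_ ?_ ?_ L hL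
    (by simp) le_rfl
  · intro s _ k M hM
    rw [del_sub, del_del, del_eq_zero_of_d hf x hM, sub_zero]
  · intro w hw _
    rw [del_expand hm hw, h x w hw, sub_zero]
  · intro s _ k M hM hd
    rw [del_contract hM hd, sub_self]

/-! ### The cochains that represent the generators -/

theorem path_eq_path_iff {m : ℕ} {x y : Fin (2 * m + 1)} {L M : List Step} (hL : Valid m L)
    (hM : Valid m M) : path x L = path y M ↔ x = y ∧ L = M := by
  refine ⟨fun h => ?_, fun h => by rw [h.1, h.2]⟩
  have h₁ := congrArg steps h
  rw [steps_path _ hL, steps_path _ hM] at h₁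
  obtain ⟨l, hl⟩ := path_eq_cons x L
  obtain ⟨k, hk⟩ := path_eq_cons y M
  rw [hl, hk] at h
  exact ⟨(List.cons.inj h).1, h₁⟩

theorem eCochain_path {m : ℕ} (x y : Fin (2 * m + 1)) {L : List Step} (hL : Valid m L) :
    eCochain x (path y L) = if y = x ∧ L = [] then 1 else 0 := by
  have h : path y L = [x] ↔ y = x ∧ L = [] := path_eq_path_iff (M := []) hL (valid_nil m)
  simp only [eCochain, h]

theorem aCochain_path {m : ℕ} (hm : 1 ≤ m) (x y : Fin (2 * m + 1)) (s : Bool) {L : List Step}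
    (hL : Valid m L) :
    aCochain x (move x (s, 1)) (path y L) = if y = x ∧ L = [(s, 1)] then 1 else 0 := by
  have h : path y L = [x, move x (s, 1)] ↔ y = x ∧ L = [(s, 1)] :=
    path_eq_path_iff (M := [(s, 1)]) hL (by simp [valid_cons, valid_nil, hm])
  simp only [aCochain, h]

/-- Two steps of total size `m + 1` that lead from `x` to the vertex at distance `m` from `x` in the
direction opposite to `s` both have direction `s`. -/
theorem move_move_eq_iff {m : ℕ} {p q : Step} (x : Fin (2 * m + 1)) (s : Bool)
    (hp : 1 ≤ p.2 ∧ p.2 ≤ m) (hq : 1 ≤ q.2 ∧ q.2 ≤ m) (h : p.2 + q.2 = m + 1) :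
    move (move x p) q = move x (s, m + 1) ↔ p.1 = s ∧ q.1 = s := by
  obtain ⟨t, i⟩ := p
  obtain ⟨u, j⟩ := q
  simp only at hp hq h ⊢
  refine ⟨fun heq => ?_, ?_⟩
  · have hd := dist_move x (a := (s, m + 1)) (by simp only; omega)
    simp only at hd
    rw [← heq] at hd
    by_cases htu : t = u
    · subst htu
      refine (and_self_iff).2 ?_
      by_contra hts
      obtain rfl : t = !s := by cases s <;> cases t <;> simp_all
      rw [move_move, h, move_not x s (k := m) (by omega), ← move_move] at heq
      exact ne_move _ ⟨le_rfl, by omega⟩ heq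
    · exfalso
      obtain rfl : u = !t := by cases t <;> cases u <;> simp_all
      rcases Nat.le_total j i with hij | hij
      · obtain ⟨k, rfl⟩ := Nat.exists_eq_add_of_le' hij
        rw [← move_move, move_move_not, dist_move _ (by simp only; omega)] at hd
        simp only at hd
        omega
      · obtain ⟨k, rfl⟩ := Nat.exists_eq_add_of_le hij
        rw [← move_move _ (!t), move_move_not, dist_move _ (by simp only; omega)] at hd
        simp only at hd
        omega
  · rintro ⟨rfl, rfl⟩
    rw [move_move, h]

/-- The values on step sequences of the cochain that represents `b` in the direction `s`. -/
def pairVal (m : ℕ) (s : Bool) : List Step → ℤ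
  | [p, q] => if p.1 = s ∧ q.1 = s ∧ p.2 + q.2 = m + 1 then 1 else 0
  | _ => 0

theorem bCochain_path {m : ℕ} (x y : Fin (2 * m + 1)) (s : Bool) {L : List Step}
    (hL : Valid m L) :
    bCochain (oddCycle m) (m + 1) x (move x (s, m + 1)) (path y L) =
      if y = x then pairVal m s L else 0 := by
  rw [bCochain]
  have hlen : ∀ v z, path y L = [x, v, z] → L.length = 2 := by
    intro v z h
    have := length_path y L
    rw [h] at this
    simpa using this.symm
  match L with
  | [] =>
    rw [if_neg (by rintro ⟨v, h, -⟩; simpa using hlen _ _ h)]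
    simp [pairVal]
  | [_] =>
    rw [if_neg (by rintro ⟨v, h, -⟩; simpa using hlen _ _ h)]
    simp [pairVal]
  | [p, q] =>
    obtain ⟨hp, hq⟩ := valid_cons.1 hL
    have hq := (valid_cons.1 hq).1
    rw [tupleLength_path _ hL]
    have hsize : totalSize [p, q] = p.2 + q.2 := by simp [totalSize]
    have hiff : (∃ v, path y [p, q] = [x, v, move x (s, m + 1)] ∧ IsSimplex (path y [p, q]) ∧
        totalSize [p, q] = m + 1) ↔ y = x ∧ p.1 = s ∧ q.1 = s ∧ p.2 + q.2 = m + 1 := by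
      rw [hsize]
      constructor
      · rintro ⟨v, h, -, h'⟩
        simp only [path, List.cons.injEq, and_true] at h
        obtain ⟨rfl, -, hz⟩ := h
        have := (move_move_eq_iff y s hp hq h').1 hz
        exact ⟨rfl, this.1, this.2, h'⟩
      · rintro ⟨rfl, h₁, h₂, h'⟩
        refine ⟨move y p, ?_, isSimplex_path _ hL, h'⟩
        simp only [path, (move_move_eq_iff y s hp hq h').2 ⟨h₁, h₂⟩]
    simp only [pairVal, hiff, ite_and]
  | _ :: _ :: _ :: _ =>
    rw [if_neg (by rintro ⟨v, h, -⟩; simpa using hlen _ _ h)]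
    simp [pairVal]

theorem eCochain_mem {m : ℕ} (x : Fin (2 * m + 1)) : eCochain x ∈ Cochain (oddCycle m) := by
  have key : ∀ s, eCochain x s ≠ 0 → s = [x] := fun s hs => by
    by_contra h
    exact hs (if_neg h)
  refine ⟨fun s hs => ?_, 0, fun s hs => ?_⟩
  · rw [key s hs]
    exact ⟨by simp, by simp⟩
  · rw [key s hs]
    simp [tupleLength]

theorem aCochain_mem {m : ℕ} {x y : Fin (2 * m + 1)} (h : (oddCycle m).Adj x y) :
    aCochain x y ∈ Cochain (oddCycle m) := by
  have key : ∀ s, aCochain x y s ≠ 0 → s = [x, y] := fun s hs => by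
    by_contra h
    exact hs (if_neg h)
  refine ⟨fun s hs => ?_, 1, fun s hs => ?_⟩
  · rw [key s hs]
    exact ⟨by simp, by simp [h.ne]⟩
  · rw [key s hs]
    simp [tupleLength, SimpleGraph.dist_eq_one_iff_adj.2 h]

theorem bCochain_mem {V : Type*} (G : SimpleGraph V) (k : ℕ) (x z : V) :
    bCochain G k x z ∈ Cochain G := by
  have key : ∀ s, bCochain G k x z s ≠ 0 →
      ∃ y, s = [x, y, z] ∧ IsSimplex s ∧ tupleLength G s = k := fun s hs => by
    by_contra h
    exact hs (if_neg h)
  refine ⟨fun s hs => ?_, k + 2, fun s hs => ?_⟩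
  · obtain ⟨y, -, h, -⟩ := key s hs
    exact h
  · obtain ⟨y, h, -, h'⟩ := key s hs
    refine ⟨?_, by omega⟩
    rw [h]
    simp

theorem exists_move_of_adj {m : ℕ} {x y : Fin (2 * m + 1)} (h : (oddCycle m).Adj x y) :
    ∃ s, y = move x (s, 1) := by
  have h₁ := stepTo_size h.ne
  have h₂ := dist_move x (a := stepTo x y) (by omega)
  rw [move_stepTo, SimpleGraph.dist_eq_one_iff_adj.2 h] at h₂
  refine ⟨(stepTo x y).1, ?_⟩
  rw [show ((stepTo x y).1, 1) = stepTo x y from Prod.ext rfl (by simp only; omega), move_stepTo]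

/-- A vertex at distance `m` is reached in `m + 1` steps in the direction that is not the shortest
one. This is the direction of the `2`-simplices of length `m + 1` with these endpoints. -/
theorem exists_move_of_dist {m : ℕ} (hm : 1 ≤ m) {x z : Fin (2 * m + 1)}
    (h : (oddCycle m).dist x z = m) : ∃ s, z = move x (s, m + 1) := by
  have hne : x ≠ z := by
    rintro rfl
    rw [SimpleGraph.dist_self] at h
    omega
  have h₁ := stepTo_size hne
  have h₂ := dist_move x (a := stepTo x z) (by omega)
  rw [move_stepTo, h] at h₂
  refine ⟨!(stepTo x z).1, ?_⟩
  rw [move_not x (stepTo x z).1 (k := m) (by omega),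
    show ((stepTo x z).1, m) = stepTo x z from Prod.ext rfl (by simp only; omega), move_stepTo]

theorem adj_move {m : ℕ} (hm : 1 ≤ m) (x : Fin (2 * m + 1)) (s : Bool) :
    (oddCycle m).Adj x (move x (s, 1)) := by
  rw [← SimpleGraph.dist_eq_one_iff_adj, dist_move x (by simp only; omega)]
  simp only
  omega

theorem dist_move_succ {m : ℕ} (x : Fin (2 * m + 1)) (s : Bool) :
    (oddCycle m).dist x (move x (s, m + 1)) = m := by
  rw [dist_move x (by simp only; omega)]
  simp only
  omega

theorem del_eq_zero_of_nil {m : ℕ} {f : List Step → ℤ} (hf : ∀ a L, f (a :: L) = 0)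
    (L : List Step) : del m f L = 0 := by
  cases L with
  | nil => rfl
  | cons a L =>
    simp only [del, hf, del_zero, sub_zero]
    cases L <;> simp [headMerge, hf]

/-- A step of size `1` cannot be split. -/
theorem del_singleton {m : ℕ} (s : Bool) {L : List Step} (hL : Valid m L) :
    del m (fun M => if M = [(s, 1)] then (1 : ℤ) else 0) L = 0 := by
  cases L with
  | nil => rfl
  | cons a L =>
    rw [del, del_eq_zero_of_nil (by simp), sub_zero]
    cases L with
    | nil => rfl
    | cons b L =>
      simp only [valid_cons] at hL
      simp only [headMerge]
      split_ifs with h₁ h₂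
      · simp only [List.cons.injEq, Prod.mk.injEq] at h₂
        omega
      · rfl
      · rfl

/-- Splitting the first and splitting the second of two steps of total size `m + 1` gives the same
sequences of three steps. -/
theorem del_pairVal {m : ℕ} (s : Bool) {L : List Step} (hL : Valid m L) :
    del m (pairVal m s) L = 0 := by
  match L with
  | [] => rfl
  | [_] => rfl
  | [_, _] => simp [del, headMerge, pairVal]
  | [a, b, c] =>
    simp only [valid_cons] at hL
    obtain ⟨t, i⟩ := a
    obtain ⟨u, j⟩ := b
    obtain ⟨v, k⟩ := c
    simp only [del, headMerge, pairVal] at hL ⊢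
    split_ifs <;> grind
  | a :: b :: c :: e :: L =>
    simp only [del, headMerge, pairVal]
    rw [del_zero]
    cases L <;> simp

theorem d_eCochain {m : ℕ} (x : Fin (2 * m + 1)) :
    d (oddCycle m) ⟨eCochain x, eCochain_mem x⟩ = 0 := by
  refine d_eq_zero_of_del fun y L hL => del_eq_zero_of_nil (fun a M => ?_) L
  refine if_neg fun h => ?_
  have := congrArg List.length h
  simp [length_path] at this

theorem d_aCochain {m : ℕ} {x y : Fin (2 * m + 1)} (h : (oddCycle m).Adj x y) :
    d (oddCycle m) ⟨aCochain x y, aCochain_mem h⟩ = 0 := by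
  obtain ⟨s, rfl⟩ := exists_move_of_adj h
  have hm : 1 ≤ m := by
    rw [← SimpleGraph.dist_eq_one_iff_adj, dist_move x (by simp only; omega)] at h
    simp only at h
    omega
  refine d_eq_zero_of_del fun y L hL => ?_
  rw [del_congr_valid (fun M hM => aCochain_path hm x y s hM) hL]
  by_cases hy : y = x
  · simpa only [hy, true_and] using del_singleton s hL
  · simpa only [hy, false_and, if_false] using del_zero m L

theorem d_bCochain {m : ℕ} (hm : 1 ≤ m) {x z : Fin (2 * m + 1)} (h : (oddCycle m).dist x z = m) :
    d (oddCycle m) ⟨bCochain (oddCycle m) (m + 1) x z, bCochain_mem _ _ _ _⟩ = 0 := by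
  obtain ⟨s, rfl⟩ := exists_move_of_dist hm h
  refine d_eq_zero_of_del fun y L hL => ?_
  rw [del_congr_valid (fun M hM => bCochain_path x y s hM) hL]
  by_cases hy : y = x
  · simpa only [hy, if_true] using del_pairVal s hL
  · simpa only [hy, if_false] using del_zero m L

/-! ### Products with the generating cochains -/

theorem mulFun_of_length {V : Type*} {f : List V → ℤ} {k : ℕ}
    (hf : ∀ t, f t ≠ 0 → t.length = k + 1) (F : List V → ℤ) (l : List V) :
    mulFun f F l = if k < l.length then f (l.take (k + 1)) * F (l.drop k) else 0 := by
  have h₀ : ∀ i ∈ Finset.range l.length, i ≠ k → f (l.take (i + 1)) * F (l.drop i) = 0 := by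
    intro i hi hik
    have hi := Finset.mem_range.1 hi
    by_contra h
    have := hf _ (left_ne_zero_of_mul h)
    rw [List.length_take] at this
    omega
  rw [mulFun]
  split_ifs with hk
  · exact Finset.sum_eq_single_of_mem k (Finset.mem_range.2 hk) h₀
  · refine Finset.sum_eq_zero fun i hi => h₀ i hi ?_
    have := Finset.mem_range.1 hi
    omega

theorem mulFun_e {m : ℕ} (x y : Fin (2 * m + 1)) (F : List (Fin (2 * m + 1)) → ℤ)
    (L : List Step) :
    mulFun (eCochain x) F (path y L) = if y = x then F (path y L) else 0 := by
  rw [mulFun_of_length (k := 0)]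
  · obtain ⟨l, hl⟩ := path_eq_cons y L
    rw [hl]
    simp [eCochain]
  · intro t ht
    rw [show t = [x] by by_contra h; exact ht (if_neg h)]
    rfl

theorem length_of_aCochain_ne_zero {V : Type*} {x y : V} {t : List V}
    (ht : aCochain x y t ≠ 0) : t.length = 1 + 1 := by
  rw [show t = [x, y] by by_contra h; exact ht (if_neg h)]
  rfl

theorem mulFun_a_nil {m : ℕ} (x z y : Fin (2 * m + 1)) (F : List (Fin (2 * m + 1)) → ℤ) :
    mulFun (aCochain x z) F (path y []) = 0 := by
  rw [mulFun_of_length fun t => length_of_aCochain_ne_zero]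
  simp [path]

theorem mulFun_a_cons {m : ℕ} (hm : 1 ≤ m) (x y : Fin (2 * m + 1)) (s : Bool)
    (F : List (Fin (2 * m + 1)) → ℤ) {a : Step} (ha : 1 ≤ a.2 ∧ a.2 ≤ m) (L : List Step) :
    mulFun (aCochain x (move x (s, 1))) F (path y (a :: L)) =
      if y = x ∧ a = (s, 1) then F (path (move x (s, 1)) L) else 0 := by
  rw [mulFun_of_length fun t => length_of_aCochain_ne_zero]
  have h₁ : (path y (a :: L)).take 2 = path y [a] := by
    obtain ⟨l, hl⟩ := path_eq_cons (move y a) L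
    simp [path, hl]
  have h₂ : (path y (a :: L)).drop 1 = path (move y a) L := rfl
  rw [h₁, h₂, length_path, if_pos (by simp),
    aCochain_path hm x y s (valid_cons.2 ⟨ha, valid_nil m⟩)]
  simp only [List.cons.injEq, and_true]
  split_ifs with h
  · rw [h.1, h.2, one_mul]
  · rw [zero_mul]

theorem length_of_bCochain_ne_zero {V : Type*} {G : SimpleGraph V} {k : ℕ} {x y : V} {t : List V}
    (ht : bCochain G k x y t ≠ 0) : t.length = 2 + 1 := by
  have : ∃ z, t = [x, z, y] ∧ IsSimplex t ∧ tupleLength G t = k := by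
    by_contra h
    exact ht (if_neg h)
  obtain ⟨z, h, -⟩ := this
  rw [h]
  rfl

theorem mulFun_b_nil {m : ℕ} (x z y : Fin (2 * m + 1)) (F : List (Fin (2 * m + 1)) → ℤ) :
    mulFun (bCochain (oddCycle m) (m + 1) x z) F (path y []) = 0 := by
  rw [mulFun_of_length fun t => length_of_bCochain_ne_zero]
  simp [path]

theorem mulFun_b_single {m : ℕ} (x z y : Fin (2 * m + 1)) (F : List (Fin (2 * m + 1)) → ℤ)
    (a : Step) : mulFun (bCochain (oddCycle m) (m + 1) x z) F (path y [a]) = 0 := by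
  rw [mulFun_of_length fun t => length_of_bCochain_ne_zero]
  simp [path]

theorem mulFun_b_cons {m : ℕ} (x y : Fin (2 * m + 1)) (s : Bool)
    (F : List (Fin (2 * m + 1)) → ℤ) {p q : Step} (hp : 1 ≤ p.2 ∧ p.2 ≤ m)
    (hq : 1 ≤ q.2 ∧ q.2 ≤ m) (L : List Step) :
    mulFun (bCochain (oddCycle m) (m + 1) x (move x (s, m + 1))) F (path y (p :: q :: L)) =
      if y = x ∧ p.1 = s ∧ q.1 = s ∧ p.2 + q.2 = m + 1 then
        F (path (move x (s, m + 1)) L) else 0 := by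
  rw [mulFun_of_length fun t => length_of_bCochain_ne_zero]
  have h₁ : (path y (p :: q :: L)).take 3 = path y [p, q] := by
    obtain ⟨l, hl⟩ := path_eq_cons (move (move y p) q) L
    simp [path, hl]
  have h₂ : (path y (p :: q :: L)).drop 2 = path (move (move y p) q) L := rfl
  rw [h₁, h₂, length_path, if_pos (by simp),
    bCochain_path x y s (valid_cons.2 ⟨hp, valid_cons.2 ⟨hq, valid_nil m⟩⟩)]
  simp only [pairVal, ← ite_and]
  split_ifs with h
  · rw [h.1, (move_move_eq_iff x s hp hq h.2.2.2).2 ⟨h.2.1, h.2.2.1⟩, one_mul]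
  · rw [zero_mul]

/-! ### Words in the generators -/

/-- The cocycle that represents a generator. -/
noncomputable def genCocycle {m : ℕ} (hm : 1 ≤ m) : Gen m → cocycles (oddCycle m)
  | .e x => ⟨⟨eCochain x, eCochain_mem x⟩, d_eCochain x⟩
  | .a x y h => ⟨⟨aCochain x y, aCochain_mem h⟩, d_aCochain h⟩
  | .b x z h => ⟨⟨bCochain (oddCycle m) (m + 1) x z, bCochain_mem _ _ _ _⟩, d_bCochain hm h⟩

/-- The product of the cocycles that represent the generators in a word. -/
noncomputable def wordCocycle {m : ℕ} (hm : 1 ≤ m) :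
    FreeSemigroup (Gen m) →ₙ* cocycles (oddCycle m) :=
  FreeSemigroup.lift (genCocycle hm)

/-- The vertex reached from `x` by a letter. -/
def target {m : ℕ} (x : Fin (2 * m + 1)) : Letter → Fin (2 * m + 1)
  | .a s => move x (s, 1)
  | .b s => move x (s, m + 1)

/-- The generator with source `x` that corresponds to a letter. -/
def letterGen {m : ℕ} (hm : 1 ≤ m) (x : Fin (2 * m + 1)) : Letter → Gen m
  | .a s => .a x (move x (s, 1)) (adj_move hm x s)
  | .b s => .b x (move x (s, m + 1)) (dist_move_succ x s)

/-- The composable word in the generators that starts at the vertex `x` and reads the given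
letters, followed by the idempotent at its endpoint. -/
def wordFrom {m : ℕ} (hm : 1 ≤ m) (x : Fin (2 * m + 1)) : List Letter → FreeSemigroup (Gen m)
  | [] => FreeSemigroup.of (.e x)
  | v :: w => FreeSemigroup.of (letterGen hm x v) * wordFrom hm (target x v) w

/-- The cochain of the word that starts at `x` and reads the letters `w`. -/
noncomputable def wordFun {m : ℕ} (hm : 1 ≤ m) (x : Fin (2 * m + 1)) (w : List Letter) :
    List (Fin (2 * m + 1)) → ℤ :=
  (wordCocycle hm (wordFrom hm x w)).1.1

theorem wordFun_nil {m : ℕ} (hm : 1 ≤ m) (x : Fin (2 * m + 1)) :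
    wordFun hm x [] = eCochain x := by
  rw [wordFun, wordFrom, wordCocycle, FreeSemigroup.lift_of]
  rfl

theorem wordFun_cons {m : ℕ} (hm : 1 ≤ m) (x : Fin (2 * m + 1)) (v : Letter) (w : List Letter) :
    wordFun hm x (v :: w) =
      mulFun (genCocycle hm (letterGen hm x v)).1.1 (wordFun hm (target x v) w) := by
  rw [wordFun, wordFrom, map_mul, wordCocycle, FreeSemigroup.lift_of]
  rfl

theorem wordFun_a {m : ℕ} (hm : 1 ≤ m) (x : Fin (2 * m + 1)) (s : Bool) (w : List Letter) :
    wordFun hm x (.a s :: w) =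
      mulFun (aCochain x (move x (s, 1))) (wordFun hm (move x (s, 1)) w) :=
  wordFun_cons hm x _ w

theorem wordFun_b {m : ℕ} (hm : 1 ≤ m) (x : Fin (2 * m + 1)) (s : Bool) (w : List Letter) :
    wordFun hm x (.b s :: w) =
      mulFun (bCochain (oddCycle m) (m + 1) x (move x (s, m + 1)))
        (wordFun hm (move x (s, m + 1)) w) :=
  wordFun_cons hm x _ w

/-- The cochain of a word is supported on simplices whose first step has the direction of the
first letter of the word. -/
theorem wordFun_eq_zero_of_dir {m : ℕ} (hm : 1 ≤ m) (x y : Fin (2 * m + 1)) {w : List Letter}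
    {s : Bool} {k : ℕ} {L : List Step} (hL : Valid m ((s, k) :: L))
    (hw : ∀ v ∈ w.head?, v.dir ≠ s) : wordFun hm x w (path y ((s, k) :: L)) = 0 := by
  obtain ⟨ha, hL'⟩ := valid_cons.1 hL
  match w with
  | [] => simp [wordFun_nil, eCochain_path x y hL]
  | .a t :: w =>
    have ht : t ≠ s := hw _ rfl
    rw [wordFun_a, mulFun_a_cons hm _ _ _ _ ha, if_neg]
    rintro ⟨-, h⟩
    exact ht (Prod.ext_iff.1 h).1.symm
  | .b t :: w =>
    have ht : t ≠ s := hw _ rfl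
    rw [wordFun_b]
    cases L with
    | nil => exact mulFun_b_single _ _ _ _ _
    | cons q L =>
      rw [mulFun_b_cons _ _ _ _ ha (valid_cons.1 hL').1, if_neg]
      rintro ⟨-, h, -⟩
      exact ht h.symm

theorem Normal.dir_head_ne {s : Bool} {w : List Letter} (h : Normal (.a s :: w)) :
    ∀ v ∈ w.head?, v.dir ≠ s := by
  cases w with
  | nil => simp
  | cons v w => simpa using h.dir_ne

/-- Evaluation on critical simplices is dual to the cochains of normal words. -/
theorem wordFun_expand {m : ℕ} (hm : 2 ≤ m) {w u : List Letter} (hw : Normal w) (hu : Normal u)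
    (x y : Fin (2 * m + 1)) :
    wordFun (by omega : 1 ≤ m) x w (path y (expand m u)) = if y = x ∧ u = w then 1 else 0 := by
  have hm1 : 1 ≤ m := by omega
  have hv := fun u => valid_expand hm1 u
  induction w generalizing u x y with
  | nil =>
    rw [wordFun_nil, eCochain_path _ _ (hv u)]
    refine if_congr (and_congr Iff.rfl ?_) rfl rfl
    match u with
    | [] => simp [expand]
    | .a _ :: _ => simp [expand]
    | .b _ :: _ => simp [expand]
  | cons v w ih =>
    match v, u with
    | .a s, [] => rw [wordFun_a, expand, mulFun_a_nil]; simp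
    | .b s, [] => rw [wordFun_b, expand, mulFun_b_nil]; simp
    | .a s, .a t :: u =>
      rw [wordFun_a, expand, mulFun_a_cons hm1 _ _ _ _ ⟨le_rfl, hm1⟩, ih hw.tail hu.tail]
      simp only [Prod.mk.injEq, and_true, List.cons.injEq, Letter.a.injEq, true_and, ← ite_and]
      exact if_congr (by tauto) rfl rfl
    | .a s, .b t :: u =>
      have := valid_cons.1 (hv (.b t :: u))
      rw [wordFun_a, expand, mulFun_a_cons hm1 _ _ _ _ this.1]
      simp only [Prod.mk.injEq, and_true, List.cons.injEq, reduceCtorEq, false_and, and_false,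
        if_false]
      split_ifs with h
      · obtain ⟨-, rfl⟩ := h
        exact wordFun_eq_zero_of_dir hm1 _ _ this.2 hw.dir_head_ne
      · rfl
    | .b s, .a t :: u =>
      have := valid_cons.1 (hv (.a t :: u))
      rw [wordFun_b, expand]
      simp only [List.cons.injEq, reduceCtorEq, false_and, and_false, if_false]
      match u with
      | [] => exact mulFun_b_single _ _ _ _ _
      | v :: u =>
        obtain ⟨L, hL⟩ := expand_cons m v u
        rw [hL, mulFun_b_cons _ _ _ _ this.1 ⟨le_rfl, hm1⟩, if_neg]
        simp only
        omega
    | .b s, .b t :: u =>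
      rw [wordFun_b, expand, mulFun_b_cons (p := (t, 1)) (q := (t, m)) _ _ _ _ ⟨le_rfl, hm1⟩
        ⟨hm1, le_rfl⟩, ih hw.tail hu.tail]
      simp only [Nat.add_comm 1 m, and_true, List.cons.injEq, Letter.b.injEq, and_self, true_and,
        ← ite_and]
      exact if_congr (by tauto) rfl rfl

/-! ### Relations in cohomology -/

/-- The class of a cocycle. -/
noncomputable abbrev mkMH {m : ℕ} (z : cocycles (oddCycle m)) : MH (oddCycle m) :=
  Ideal.Quotient.mk (coboundaries (oddCycle m)) z

/-- A cohomology class is determined by its values on critical simplices. -/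
theorem mkMH_eq_iff {m : ℕ} (hm : 1 ≤ m) {z z' : cocycles (oddCycle m)} :
    mkMH z = mkMH z' ↔ ∀ x w, Normal w →
      z.1.1 (path x (expand m w)) = z'.1.1 (path x (expand m w)) := by
  rw [Ideal.Quotient.eq]
  constructor
  · rintro ⟨g, hg⟩ x w hw
    have h : (d (oddCycle m) g).1 (path x (expand m w)) = 0 := by
      rw [d_path _ _ (valid_expand hm w), del_expand hm hw]
    rw [hg] at h
    exact sub_eq_zero.1 h
  · intro h
    obtain ⟨g, hg⟩ := exists_d_eq (f := (z - z').1) hm (d_eq_zero _)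
      (fun x w hw => sub_eq_zero.2 (h x w hw))
    exact ⟨g, hg⟩

/-- The cohomology class of a generator. -/
noncomputable def genClass {m : ℕ} (hm : 1 ≤ m) (g : Gen m) : MH (oddCycle m) :=
  mkMH (genCocycle hm g)

theorem genClass_e_mul_self {m : ℕ} (hm : 1 ≤ m) (x : Fin (2 * m + 1)) :
    genClass hm (.e x) * genClass hm (.e x) = genClass hm (.e x) := by
  refine (mkMH_eq_iff hm).2 fun y w _ => ?_
  change mulFun (eCochain x) (eCochain x) _ = eCochain x _
  rw [mulFun_e, eCochain_path _ _ (valid_expand hm w)]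
  split_ifs <;> tauto

theorem genClass_e_mul_e {m : ℕ} (hm : 1 ≤ m) {x x' : Fin (2 * m + 1)} (h : x ≠ x') :
    genClass hm (.e x) * genClass hm (.e x') = 0 := by
  refine (mkMH_eq_iff (z' := 0) hm).2 fun y w _ => ?_
  change mulFun (eCochain x) (eCochain x') _ = 0
  rw [mulFun_e, eCochain_path _ _ (valid_expand hm w)]
  split_ifs with h₁ h₂
  · exact absurd (h₁.symm.trans h₂.1) h
  · rfl
  · rfl

theorem genClass_e_mul_a {m : ℕ} (hm : 1 ≤ m) (x y : Fin (2 * m + 1)) (h) :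
    genClass hm (.e x) * genClass hm (.a x y h) = genClass hm (.a x y h) := by
  obtain ⟨s, rfl⟩ := exists_move_of_adj h
  refine (mkMH_eq_iff hm).2 fun y w _ => ?_
  change mulFun (eCochain x) (aCochain x _) _ = aCochain x _ _
  rw [mulFun_e, aCochain_path hm _ _ _ (valid_expand hm w)]
  split_ifs <;> tauto

theorem genClass_e_mul_b {m : ℕ} (hm : 1 ≤ m) (x z : Fin (2 * m + 1)) (h) :
    genClass hm (.e x) * genClass hm (.b x z h) = genClass hm (.b x z h) := by
  obtain ⟨s, rfl⟩ := exists_move_of_dist hm h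
  refine (mkMH_eq_iff hm).2 fun y w _ => ?_
  change mulFun (eCochain x) (bCochain _ _ x _) _ = bCochain _ _ x _ _
  rw [mulFun_e, bCochain_path _ _ _ (valid_expand hm w)]
  split_ifs <;> rfl

theorem genClass_a_mul_e {m : ℕ} (hm : 1 ≤ m) (x y : Fin (2 * m + 1)) (h) :
    genClass hm (.a x y h) * genClass hm (.e y) = genClass hm (.a x y h) := by
  obtain ⟨s, rfl⟩ := exists_move_of_adj h
  refine (mkMH_eq_iff hm).2 fun y w _ => ?_
  change mulFun (aCochain x _) (eCochain _) _ = aCochain x _ _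
  have hv := valid_expand hm w
  rw [aCochain_path hm _ _ _ hv]
  revert hv
  generalize expand m w = L
  intro hv
  cases L with
  | nil => rw [mulFun_a_nil]; simp
  | cons a L =>
    obtain ⟨ha, hL⟩ := valid_cons.1 hv
    rw [mulFun_a_cons hm _ _ _ _ ha, eCochain_path _ _ hL, ← ite_and]
    refine if_congr ?_ rfl rfl
    simp only [List.cons.injEq]
    tauto

theorem genClass_b_mul_e {m : ℕ} (hm : 1 ≤ m) (x z : Fin (2 * m + 1)) (h) :
    genClass hm (.b x z h) * genClass hm (.e z) = genClass hm (.b x z h) := by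
  obtain ⟨s, rfl⟩ := exists_move_of_dist hm h
  refine (mkMH_eq_iff hm).2 fun y w _ => ?_
  change mulFun (bCochain _ _ x _) (eCochain _) _ = bCochain _ _ x _ _
  have hv := valid_expand hm w
  rw [bCochain_path _ _ _ hv]
  revert hv
  generalize expand m w = L
  intro hv
  match L with
  | [] => rw [mulFun_b_nil]; simp [pairVal]
  | [_] => rw [mulFun_b_single]; simp [pairVal]
  | p :: q :: L =>
    simp only [valid_cons] at hv
    rw [mulFun_b_cons _ _ _ _ hv.1 hv.2.1, eCochain_path _ _ hv.2.2]
    cases L <;> simp [pairVal, ← ite_and]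

theorem genClass_a_mul_a {m : ℕ} (hm : 2 ≤ m) (x y z : Fin (2 * m + 1)) (hxy hyz) (hxz : x ≠ z) :
    genClass (by omega : 1 ≤ m) (.a x y hxy) * genClass (by omega) (.a y z hyz) = 0 := by
  have hm1 : 1 ≤ m := by omega
  obtain ⟨s, rfl⟩ := exists_move_of_adj hxy
  obtain ⟨t, rfl⟩ := exists_move_of_adj hyz
  obtain rfl : s = t := by
    by_contra hst
    obtain rfl : t = !s := by cases s <;> cases t <;> simp_all
    exact hxz (move_move_not x s 1).symm
  refine (mkMH_eq_iff (z' := 0) hm1).2 fun y w hw => ?_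
  change mulFun (aCochain x _) (aCochain _ _) _ = 0
  have hv := valid_expand hm1 w
  match w with
  | [] => exact mulFun_a_nil _ _ _ _
  | .b u :: w =>
    obtain ⟨h₁, h₂⟩ := valid_cons.1 hv
    rw [expand, mulFun_a_cons hm1 _ _ _ _ h₁, aCochain_path hm1 _ _ _ h₂]
    split_ifs with h h'
    · simp only [List.cons.injEq, Prod.mk.injEq] at h'
      omega
    · rfl
    · rfl
  | .a u :: w =>
    obtain ⟨h₁, h₂⟩ := valid_cons.1 hv
    rw [expand, mulFun_a_cons hm1 _ _ _ _ h₁, aCochain_path hm1 _ _ _ h₂]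
    split_ifs with h h'
    · exfalso
      cases w with
      | nil => simp [expand] at h'
      | cons v w =>
        obtain ⟨L, hL⟩ := expand_cons m v w
        rw [hL] at h'
        simp only [List.cons.injEq, Prod.mk.injEq] at h h'
        exact hw.dir_ne (h'.2.1.1.trans h.2.1.symm)
    · rfl
    · rfl

/-- Both products agree with the cochain dual to the simplex with steps of sizes `1`, `m`, `1` as
far as critical simplices are concerned. -/
theorem genClass_a_mul_b {m : ℕ} (hm : 2 ≤ m) (w x y z : Fin (2 * m + 1)) (hwx hxz hwy hyz)
    (hxy : (oddCycle m).dist x y = m) :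
    genClass (by omega : 1 ≤ m) (.a w x hwx) * genClass (by omega) (.b x z hxz) =
      genClass (by omega : 1 ≤ m) (.b w y hwy) * genClass (by omega) (.a y z hyz) := by
  have hm1 : 1 ≤ m := by omega
  obtain ⟨s, rfl⟩ := exists_move_of_adj hwx
  -- This excludes all configurations in which the edges and the long steps do not all have the
  -- same direction.
  have hdist : ∀ r, (oddCycle m).dist (move w (s, 1)) (move (move w (s, 1)) (r, m - 1)) ≠ m := by
    intro r
    rw [dist_move _ (by simp only; omega)]
    simp only
    omega
  obtain ⟨r, rfl⟩ := exists_move_of_dist hm1 hwy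
  obtain rfl : r = s := by
    by_contra hrs
    obtain rfl : r = !s := by cases r <;> cases s <;> simp_all
    refine hdist s ?_
    rw [move_move, show 1 + (m - 1) = m by omega,
      ← move_not w s (show m + 1 + m = 2 * m + 1 by omega)]
    exact hxy
  obtain ⟨q, rfl⟩ := exists_move_of_adj hyz
  obtain rfl : q = r := by
    by_contra hqr
    obtain rfl : q = !r := by cases q <;> cases r <;> simp_all
    refine hdist r ?_
    rw [move_move, show 1 + (m - 1) = m by omega]
    rw [← move_move, move_move_not] at hxz
    exact hxz
  have hz : move (move w (q, m + 1)) (q, 1) = move (move w (q, 1)) (q, m + 1) := by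
    simp only [move_move, Nat.add_comm 1]
  refine (mkMH_eq_iff hm1).2 fun v u hu => ?_
  change mulFun (aCochain _ _) (bCochain _ _ _ _) _ = mulFun (bCochain _ _ _ _) (aCochain _ _) _
  have hv := valid_expand hm1 u
  rw [hz]
  match u with
  | [] =>
    rw [expand, mulFun_a_nil, mulFun_b_nil]
  | .a t :: u =>
    obtain ⟨h₁, h₂⟩ := valid_cons.1 hv
    -- A critical sequence that begins with a single step of size `1` for an `a` turns around
    -- afterwards, so neither product sees it.
    have hl : pairVal m q (expand m u) = 0 ∨ t ≠ q := by
      refine or_iff_not_imp_right.2 fun h => ?_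
      obtain rfl : t = q := not_not.1 h
      cases u with
      | nil => rfl
      | cons c u =>
        obtain ⟨L, hL⟩ := expand_cons m c u
        rw [hL]
        cases L with
        | nil => rfl
        | cons e L => cases L <;> simp [pairVal, hu.dir_ne]
    have hr : mulFun (bCochain (oddCycle m) (m + 1) w (move w (q, m + 1)))
        (aCochain (move w (q, m + 1)) (move (move w (q, 1)) (q, m + 1)))
        (path v (expand m (.a t :: u))) = 0 := by
      cases u with
      | nil => exact mulFun_b_single _ _ _ _ _
      | cons c u =>
        obtain ⟨L, hL⟩ := expand_cons m c u
        rw [expand, hL, mulFun_b_cons _ _ _ _ h₁ ⟨le_rfl, hm1⟩, if_neg]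
        simp only
        omega
    rw [hr, expand, mulFun_a_cons hm1 _ _ _ _ h₁, bCochain_path _ _ _ h₂]
    rcases hl with h | h
    · rw [h, ite_self, ite_self]
    · rw [if_neg]
      simp [h]
  | .b t :: u =>
    obtain ⟨h₁, h₂⟩ := valid_cons.1 hv
    obtain ⟨h₃, h₄⟩ := valid_cons.1 h₂
    have hp : ∀ L, pairVal m q ((q, m) :: L) = if L = [(q, 1)] then 1 else 0 := by
      intro L
      match L with
      | [] => simp [pairVal]
      | [(c, k)] => simp [pairVal]
      | _ :: _ :: _ => simp [pairVal]
    rw [← hz, expand, mulFun_a_cons hm1 _ _ _ _ h₁,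
      mulFun_b_cons (p := (t, 1)) (q := (t, m)) _ _ _ _ h₁ h₃, aCochain_path hm1 _ _ _ h₄, hz,
      bCochain_path _ _ _ h₂]
    by_cases h : v = w ∧ t = q
    · obtain ⟨rfl, rfl⟩ := h
      simp [hp, Nat.add_comm]
    · rw [if_neg, if_neg]
      · tauto
      · simpa using h

/-! ### The presented ring is spanned by normal words -/

theorem toPresented_add {m : ℕ} (r r' : FreeRng m) :
    toPresented (r + r') = toPresented r + toPresented r' := rfl

theorem toPresented_mul {m : ℕ} (r r' : FreeRng m) :
    toPresented (r * r') = toPresented r * toPresented r' := rfl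

theorem toPresented_zsmul {m : ℕ} (n : ℤ) (r : FreeRng m) :
    toPresented (n • r) = n • toPresented r :=
  map_zsmul (⟨⟨toPresented, rfl⟩, toPresented_add⟩ : FreeRng m →+ PresentedRing m) n r

theorem toPresented_eq_of_rel {m : ℕ} {r r' : FreeRng m} (h : Rel m r r') :
    toPresented r = toPresented r' :=
  (RingCon.eq _).2 (RingConGen.Rel.of _ _ h)

/-- The element of the presented ring given by a word in the generators. -/
noncomputable def wordElt {m : ℕ} (w : FreeSemigroup (Gen m)) : PresentedRing m :=
  toPresented (MonoidAlgebra.single w 1)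

/-- The element of the presented ring given by a generator. -/
noncomputable def genElt {m : ℕ} (g : Gen m) : PresentedRing m :=
  toPresented (gen g)

theorem wordElt_of {m : ℕ} (g : Gen m) : wordElt (FreeSemigroup.of g) = genElt g := rfl

theorem wordElt_mul {m : ℕ} (w w' : FreeSemigroup (Gen m)) :
    wordElt (w * w') = wordElt w * wordElt w' := by
  rw [wordElt, wordElt, wordElt, ← toPresented_mul, MonoidAlgebra.single_mul_single, one_mul]

theorem wordElt_wordFrom_cons {m : ℕ} (hm : 1 ≤ m) (x : Fin (2 * m + 1)) (v : Letter)
    (w : List Letter) :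
    wordElt (wordFrom hm x (v :: w)) =
      genElt (letterGen hm x v) * wordElt (wordFrom hm (target x v) w) :=
  wordElt_mul _ _

theorem genElt_mul_of_rel {m : ℕ} {g g' h : Gen m} (H : Rel m (gen g * gen g') (gen h)) :
    genElt g * genElt g' = genElt h :=
  toPresented_eq_of_rel H

theorem e_mul_wordElt {m : ℕ} (hm : 1 ≤ m) (x : Fin (2 * m + 1)) (w : List Letter) :
    genElt (.e x) * wordElt (wordFrom hm x w) = wordElt (wordFrom hm x w) := by
  match w with
  | [] => exact genElt_mul_of_rel (.e_mul_self x)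
  | .a s :: w =>
    rw [wordElt_wordFrom_cons, ← mul_assoc]
    congr 1
    exact genElt_mul_of_rel (.e_mul_a _ _ _)
  | .b s :: w =>
    rw [wordElt_wordFrom_cons, ← mul_assoc]
    congr 1
    exact genElt_mul_of_rel (.e_mul_b _ _ _)

theorem e_mul_wordElt_of_ne {m : ℕ} (hm : 1 ≤ m) {x y : Fin (2 * m + 1)} (h : x ≠ y)
    (w : List Letter) : genElt (.e x) * wordElt (wordFrom hm y w) = 0 := by
  rw [← e_mul_wordElt, ← mul_assoc]
  have : genElt (.e x) * genElt (.e y) = (0 : PresentedRing m) :=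
    toPresented_eq_of_rel (.e_mul_e x y h)
  rw [this, zero_mul]

/-- The subgroup of the presented ring spanned by the normal words. -/
noncomputable def normalSpan {m : ℕ} (hm : 1 ≤ m) : AddSubgroup (PresentedRing m) :=
  AddSubgroup.closure {r | ∃ x w, Normal w ∧ r = wordElt (wordFrom hm x w)}

theorem wordElt_mem {m : ℕ} (hm : 1 ≤ m) (x : Fin (2 * m + 1)) {w : List Letter}
    (hw : Normal w) : wordElt (wordFrom hm x w) ∈ normalSpan hm :=
  AddSubgroup.subset_closure ⟨x, w, hw, rfl⟩

/-- To see that left multiplication by an element preserves the span of the normal words, it is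
enough to consider normal words. -/
theorem mul_mem_normalSpan {m : ℕ} (hm : 1 ≤ m) {g r : PresentedRing m}
    (hg : ∀ x w, Normal w → g * wordElt (wordFrom hm x w) ∈ normalSpan hm)
    (hr : r ∈ normalSpan hm) : g * r ∈ normalSpan hm := by
  induction hr using AddSubgroup.closure_induction with
  | mem r hr =>
    obtain ⟨x, w, hw, rfl⟩ := hr
    exact hg x w hw
  | zero => rw [mul_zero]; exact zero_mem _
  | add r r' _ _ h h' => rw [mul_add]; exact add_mem h h'
  | neg r _ h =>
    have : g * -r = -(g * r) :=
      eq_neg_of_add_eq_zero_left (by rw [← mul_add, neg_add_cancel, mul_zero])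
    rw [this]
    exact neg_mem h

theorem b_mul_wordElt_mem {m : ℕ} (hm : 1 ≤ m) (x z : Fin (2 * m + 1)) (h) (y : Fin (2 * m + 1))
    {w : List Letter} (hw : Normal w) :
    genElt (.b x z h) * wordElt (wordFrom hm y w) ∈ normalSpan hm := by
  by_cases hy : z = y
  · subst hy
    obtain ⟨s, rfl⟩ := exists_move_of_dist hm h
    rw [show genElt (.b x (move x (s, m + 1)) h) * wordElt (wordFrom hm (move x (s, m + 1)) w) =
      wordElt (wordFrom hm x (.b s :: w)) from (wordElt_wordFrom_cons hm x (.b s) w).symm]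
    exact wordElt_mem hm x (hw.cons_b s)
  · rw [← genElt_mul_of_rel (.b_mul_e x z h), mul_assoc, e_mul_wordElt_of_ne hm hy, mul_zero]
    exact zero_mem _

theorem inCyclicOrder_move {m : ℕ} (hm : 2 ≤ m) (x : Fin (2 * m + 1)) (s : Bool) :
    InCyclicOrder x (move x (s, 1)) (move x (s, m + 1)) (move x (s, m + 2)) := by
  have hv : ∀ {k}, k < 2 * m + 1 → (Fin.ofNat (2 * m + 1) k).val = k := Nat.mod_eq_of_lt
  have hlt : 0 < Fin.ofNat (2 * m + 1) 1 ∧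
      Fin.ofNat (2 * m + 1) 1 < Fin.ofNat (2 * m + 1) (m + 1) ∧
      Fin.ofNat (2 * m + 1) (m + 1) < Fin.ofNat (2 * m + 1) (m + 2) := by
    simp only [Fin.lt_def, hv (show 1 < 2 * m + 1 by omega),
      hv (show m + 1 < 2 * m + 1 by omega), hv (show m + 2 < 2 * m + 1 by omega)]
    exact ⟨Nat.one_pos, by omega, by omega⟩
  cases s
  · right
    simpa only [move, Bool.false_eq_true, if_false, sub_sub_cancel] using hlt
  · left
    simpa only [move, if_true, add_sub_cancel_left] using hlt

/-- The rewriting step: an `a` moves to the right past all `b`s of the same direction until it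
meets a letter of the other direction, or another `a`, in which case the product vanishes. -/
theorem a_mul_wordElt_mem {m : ℕ} (hm : 2 ≤ m) {w : List Letter} (hw : Normal w)
    (x y z : Fin (2 * m + 1)) (h) :
    genElt (.a x y h) * wordElt (wordFrom (by omega : 1 ≤ m) z w) ∈
      normalSpan (by omega : 1 ≤ m) := by
  have hm1 : 1 ≤ m := by omega
  by_cases hy : y ≠ z
  · rw [← genElt_mul_of_rel (.a_mul_e x y h), mul_assoc, e_mul_wordElt_of_ne hm1 hy, mul_zero]
    exact zero_mem _
  obtain rfl := not_not.1 hy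
  induction w generalizing x y with
  | nil =>
    rw [wordFrom, wordElt_of, genElt_mul_of_rel (.a_mul_e x y h)]
    obtain ⟨s, rfl⟩ := exists_move_of_adj h
    have := wordElt_mem hm1 x (w := [.a s]) (by simp [Normal])
    rw [wordElt_wordFrom_cons, wordFrom, wordElt_of] at this
    rwa [← genElt_mul_of_rel (.a_mul_e x _ h)]
  | cons v w ih =>
    obtain ⟨s, rfl⟩ := exists_move_of_adj h
    by_cases hv : v.dir ≠ s
    · have := wordElt_mem hm1 x (hw.cons_a hv)
      rwa [wordElt_wordFrom_cons] at this
    · rw [wordElt_wordFrom_cons, ← mul_assoc]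
      match v with
      | .a t =>
        obtain rfl : t = s := not_not.1 hv
        have hne : x ≠ move (move x (t, 1)) (t, 1) := by
          rw [move_move]
          exact ne_move x ⟨by omega, hm⟩
        have : genElt (.a x (move x (t, 1)) h) * genElt (letterGen hm1 (move x (t, 1)) (.a t)) =
            (0 : PresentedRing m) := toPresented_eq_of_rel (.a_mul_a _ _ _ _ _ hne)
        rw [this, zero_mul]
        exact zero_mem _
      | .b t =>
        obtain rfl : t = s := not_not.1 hv
        have hz : move (move x (t, 1)) (t, m + 1) = move x (t, m + 2) := by
          rw [move_move, show 1 + (m + 1) = m + 2 by omega]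
        have hz' : move (move x (t, m + 1)) (t, 1) = move (move x (t, 1)) (t, m + 1) := by
          rw [hz, move_move]
        have hy : move (move x (t, 1)) (t, m) = move x (t, m + 1) := by
          rw [move_move, show 1 + m = m + 1 by omega]
        have hadj := adj_move hm1 (move x (t, m + 1)) t
        rw [hz'] at hadj
        have hdist := dist_move (move x (t, 1)) (a := (t, m)) (by simp only; omega)
        rw [hy, min_eq_left (by simp only; omega)] at hdist
        have hcyc := inCyclicOrder_move hm x t
        rw [← hz] at hcyc
        have : genElt (.a x (move x (t, 1)) h) * genElt (letterGen hm1 (move x (t, 1)) (.b t)) =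
            genElt (.b x (move x (t, m + 1)) (dist_move_succ x t)) *
              genElt (.a (move x (t, m + 1)) (move (move x (t, 1)) (t, m + 1)) hadj) :=
          toPresented_eq_of_rel (.a_mul_b _ _ _ _ _ _ _ _ hdist hcyc)
        rw [this, mul_assoc]
        exact mul_mem_normalSpan hm1 (fun y w hw => b_mul_wordElt_mem hm1 _ _ _ y hw)
          (ih hw.tail _ _ hadj (not_not.2 rfl))

theorem genElt_mul_mem {m : ℕ} (hm : 2 ≤ m) (g : Gen m) {r : PresentedRing m}
    (hr : r ∈ normalSpan (by omega : 1 ≤ m)) : genElt g * r ∈ normalSpan (by omega : 1 ≤ m) := by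
  have hm1 : 1 ≤ m := by omega
  refine mul_mem_normalSpan hm1 (fun y w hw => ?_) hr
  match g with
  | .a x z h => exact a_mul_wordElt_mem hm hw x z y h
  | .b x z h => exact b_mul_wordElt_mem hm1 x z h y hw
  | .e x =>
    by_cases hx : x = y
    · subst hx
      rw [e_mul_wordElt]
      exact wordElt_mem hm1 x hw
    · rw [e_mul_wordElt_of_ne hm1 hx]
      exact zero_mem _

theorem e_mem {m : ℕ} (hm : 1 ≤ m) (x : Fin (2 * m + 1)) :
    (genElt (.e x) : PresentedRing m) ∈ normalSpan hm :=
  wordElt_mem hm x (w := []) (by simp [Normal])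

theorem wordElt_mem_normalSpan {m : ℕ} (hm : 2 ≤ m) (w : FreeSemigroup (Gen m)) :
    wordElt w ∈ normalSpan (by omega : 1 ≤ m) := by
  have hm1 : 1 ≤ m := by omega
  induction w using FreeSemigroup.recOnMul with
  | ih1 g =>
    rw [wordElt_of]
    match g with
    | .e x => exact e_mem hm1 x
    | .a x y h =>
      rw [← genElt_mul_of_rel (.a_mul_e x y h)]
      exact genElt_mul_mem hm _ (e_mem hm1 y)
    | .b x z h =>
      rw [← genElt_mul_of_rel (.b_mul_e x z h)]
      exact genElt_mul_mem hm _ (e_mem hm1 z)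
  | ih2 g w _ h =>
    rw [wordElt_mul, wordElt_of]
    exact genElt_mul_mem hm g h

theorem mem_normalSpan {m : ℕ} (hm : 2 ≤ m) (r : PresentedRing m) :
    r ∈ normalSpan (by omega : 1 ≤ m) := by
  obtain ⟨r, rfl⟩ : ∃ r', toPresented r' = r := Quotient.exists_rep r
  induction r using MonoidAlgebra.induction_linear with
  | zero => exact zero_mem _
  | add r r' h h' => exact add_mem h h'
  | single w n =>
    have h : toPresented (MonoidAlgebra.single w n) = n • wordElt w := by
      rw [wordElt, ← toPresented_zsmul, MonoidAlgebra.smul_single, smul_eq_mul, mul_one]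
    rw [h]
    exact zsmul_mem (wordElt_mem_normalSpan hm w) n

/-! ### The homomorphism to cohomology -/

/-- The class of the product of the cocycles that represent the generators in a word. -/
noncomputable def wordClass {m : ℕ} (hm : 1 ≤ m) : FreeSemigroup (Gen m) →ₙ* MH (oddCycle m) where
  toFun w := mkMH (wordCocycle hm w)
  map_mul' w w' := by
    rw [map_mul]
    rfl

/-- The homomorphism from the free ring that sends each generator to the class of the same name. -/
noncomputable def freeMap {m : ℕ} (hm : 1 ≤ m) : FreeRng m →ₙₐ[ℤ] MH (oddCycle m) :=
  MonoidAlgebra.liftMagma ℤ (wordClass hm)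

theorem freeMap_single {m : ℕ} (hm : 1 ≤ m) (w : FreeSemigroup (Gen m)) :
    freeMap hm (MonoidAlgebra.single w 1) = mkMH (wordCocycle hm w) := by
  simp [freeMap, wordClass]

theorem freeMap_gen {m : ℕ} (hm : 1 ≤ m) (g : Gen m) : freeMap hm (gen g) = genClass hm g :=
  freeMap_single hm _

theorem freeMap_eq_of_rel {m : ℕ} (hm : 2 ≤ m) {r r' : FreeRng m} (h : Rel m r r') :
    freeMap (by omega : 1 ≤ m) r = freeMap (by omega) r' := by
  have hm1 : 1 ≤ m := by omega
  cases h <;> simp only [map_mul, map_zero, freeMap_gen]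
  case e_mul_self x => exact genClass_e_mul_self hm1 x
  case e_mul_e x y h => exact genClass_e_mul_e hm1 h
  case e_mul_a x y h => exact genClass_e_mul_a hm1 x y h
  case a_mul_e x y h => exact genClass_a_mul_e hm1 x y h
  case e_mul_b x z h => exact genClass_e_mul_b hm1 x z h
  case b_mul_e x z h => exact genClass_b_mul_e hm1 x z h
  case a_mul_a x y z hxy hyz h => exact genClass_a_mul_a hm x y z hxy hyz h
  case a_mul_b w x y z hwx hxz hwy hyz hxy _ =>
    exact genClass_a_mul_b hm w x y z hwx hxz hwy hyz hxy

/-- The congruence on the free ring that identifies elements with the same cohomology class. -/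
def kerCon {m : ℕ} (hm : 1 ≤ m) : RingCon (FreeRng m) where
  r a b := freeMap hm a = freeMap hm b
  iseqv := ⟨fun _ => rfl, Eq.symm, Eq.trans⟩
  add' h h' := by rw [map_add, map_add, h, h']
  mul' h h' := by rw [map_mul, map_mul, h, h']

theorem freeMap_eq_of_ringConGen {m : ℕ} (hm : 2 ≤ m) {r r' : FreeRng m}
    (h : ringConGen (Rel m) r r') : freeMap (by omega : 1 ≤ m) r = freeMap (by omega) r' := by
  have hle : ringConGen (Rel m) ≤ kerCon (by omega : 1 ≤ m) :=
    RingCon.ringConGen_le.2 fun _ _ h => freeMap_eq_of_rel hm h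
  exact hle h

/-- The homomorphism from the presented ring that sends each generator to the class of the same
name. -/
noncomputable def presentedMap {m : ℕ} (hm : 2 ≤ m) : PresentedRing m →ₙ+* MH (oddCycle m) where
  toFun := Quotient.lift (s := (ringConGen (Rel m)).toSetoid) (freeMap (by omega : 1 ≤ m))
    fun _ _ h => freeMap_eq_of_ringConGen hm h
  map_zero' := map_zero (freeMap _)
  map_add' := by
    rintro ⟨r⟩ ⟨r'⟩
    exact map_add (freeMap _) r r'
  map_mul' := by
    rintro ⟨r⟩ ⟨r'⟩
    exact map_mul (freeMap _) r r'

theorem presentedMap_wordElt {m : ℕ} (hm : 2 ≤ m) (w : FreeSemigroup (Gen m)) :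
    presentedMap hm (wordElt w) = mkMH (wordCocycle (by omega : 1 ≤ m) w) :=
  freeMap_single _ w

/-! ### Bijectivity -/

/-- The normal words that start at a given vertex. -/
abbrev NormalWord (m : ℕ) : Type :=
  Fin (2 * m + 1) × {w : List Letter // Normal w}

/-- The critical simplex of a normal word. -/
def NormalWord.simplex {m : ℕ} (p : NormalWord m) : List (Fin (2 * m + 1)) :=
  path p.1 (expand m p.2.1)

/-- The word in the generators that underlies a normal word. -/
def NormalWord.word {m : ℕ} (hm : 1 ≤ m) (p : NormalWord m) : FreeSemigroup (Gen m) :=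
  wordFrom hm p.1 p.2.1

/-- Evaluation of cocycles on a tuple. -/
def evalHom {m : ℕ} (l : List (Fin (2 * m + 1))) : cocycles (oddCycle m) →+ ℤ where
  toFun z := z.1.1 l
  map_zero' := rfl
  map_add' _ _ := rfl

theorem evalHom_word {m : ℕ} (hm : 2 ≤ m) (p q : NormalWord m) :
    evalHom q.simplex (wordCocycle (by omega : 1 ≤ m) (p.word (by omega))) =
      if q = p then 1 else 0 := by
  refine (wordFun_expand hm p.2.2 q.2.2 p.1 q.1).trans (if_congr ?_ rfl rfl)
  rw [Prod.ext_iff, Subtype.ext_iff]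

theorem mkMH_eq_iff_evalHom {m : ℕ} (hm : 1 ≤ m) {z z' : cocycles (oddCycle m)} :
    mkMH z = mkMH z' ↔ ∀ p : NormalWord m, evalHom p.simplex z = evalHom p.simplex z' :=
  (mkMH_eq_iff hm).trans ⟨fun h p => h p.1 p.2.1 p.2.2, fun h x w hw => h (x, ⟨w, hw⟩)⟩

theorem exists_finsupp {m : ℕ} (hm : 2 ≤ m) (r : PresentedRing m) :
    ∃ c : NormalWord m →₀ ℤ, c.sum (fun p n => n • wordElt (p.word (by omega))) = r := by
  have hr := mem_normalSpan hm r
  induction hr using AddSubgroup.closure_induction with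
  | mem r hr =>
    obtain ⟨x, w, hw, rfl⟩ := hr
    exact ⟨.single (x, ⟨w, hw⟩) 1, by simp [NormalWord.word]⟩
  | zero => exact ⟨0, by simp⟩
  | add r r' _ _ h h' =>
    obtain ⟨c, rfl⟩ := h
    obtain ⟨c', rfl⟩ := h'
    exact ⟨c + c', Finsupp.sum_add_index' (fun _ => zero_zsmul _)
      (fun _ _ _ => add_zsmul _ _ _)⟩
  | neg r _ h =>
    obtain ⟨c, rfl⟩ := h
    exact ⟨-c, by rw [Finsupp.sum_neg_index (by simp)]; simp [Finsupp.sum]⟩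

theorem presentedMap_injective {m : ℕ} (hm : 2 ≤ m) :
    Function.Injective (presentedMap hm) := by
  rw [injective_iff_map_eq_zero]
  intro r hr
  obtain ⟨c, rfl⟩ := exists_finsupp hm r
  have h₀ : presentedMap hm (c.sum fun p n => n • wordElt (p.word (by omega))) =
      mkMH (c.sum fun p n => n • wordCocycle (by omega : 1 ≤ m) (p.word (by omega))) := by
    simp only [mkMH, map_finsuppSum, map_zsmul, presentedMap_wordElt]
  rw [h₀, ← map_zero (Ideal.Quotient.mk _)] at hr
  have hc : c = 0 := by
    ext q
    have := (mkMH_eq_iff_evalHom (by omega)).1 hr q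
    rw [map_zero, map_finsuppSum] at this
    simp only [map_zsmul, evalHom_word hm, Finsupp.sum] at this
    simpa using this
  rw [hc, Finsupp.sum_zero_index]

theorem NormalWord.simplex_injective {m : ℕ} (hm : 2 ≤ m) :
    Function.Injective (NormalWord.simplex (m := m)) := by
  intro p q h
  have h₁ := evalHom_word hm p p
  rw [h, evalHom_word hm p q, if_pos rfl] at h₁
  by_contra hne
  rw [if_neg (Ne.symm hne)] at h₁
  exact zero_ne_one h₁

/-- A cocycle is nonzero on finitely many critical simplices. -/
theorem finite_support {m : ℕ} (hm : 2 ≤ m) (z : cocycles (oddCycle m)) :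
    {p : NormalWord m | evalHom p.simplex z ≠ 0}.Finite := by
  obtain ⟨N, hN⟩ := z.1.2.2
  refine Set.Finite.subset ((List.finite_length_le _ (N + 1)).preimage
    (NormalWord.simplex_injective hm).injOn) fun p hp => ?_
  exact (hN _ hp).1

/-- A cohomology class is the combination of normal words with its values on critical simplices as
coefficients. -/
theorem mkMH_eq_presentedMap {m : ℕ} (hm : 2 ≤ m) (z : cocycles (oddCycle m)) :
    mkMH z = presentedMap hm (∑ p ∈ (finite_support hm z).toFinset,
      evalHom p.simplex z • wordElt (p.word (by omega))) := by
  have h : presentedMap hm (∑ p ∈ (finite_support hm z).toFinset,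
      evalHom p.simplex z • wordElt (p.word (by omega))) =
      mkMH (∑ p ∈ (finite_support hm z).toFinset,
        evalHom p.simplex z • wordCocycle (by omega : 1 ≤ m) (p.word (by omega))) := by
    simp only [mkMH, map_sum, map_zsmul, presentedMap_wordElt]
  rw [h, mkMH_eq_iff_evalHom (by omega)]
  intro q
  rw [map_sum]
  simp only [map_zsmul, evalHom_word hm]
  simp

theorem presentedMap_surjective {m : ℕ} (hm : 2 ≤ m) :
    Function.Surjective (presentedMap hm) := by
  intro c
  obtain ⟨z, rfl⟩ := Ideal.Quotient.mk_surjective c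
  exact ⟨_, (mkMH_eq_presentedMap hm z).symm⟩

/-! ### The bigrading -/

theorem wordBidegree_of_mul {m : ℕ} (g : Gen m) (w : FreeSemigroup (Gen m)) :
    wordBidegree (FreeSemigroup.of g * w) = g.bidegree + wordBidegree w := by
  simp [wordBidegree]

theorem wordBidegree_wordFrom {m : ℕ} (hm : 1 ≤ m) (x : Fin (2 * m + 1)) (w : List Letter) :
    wordBidegree (wordFrom hm x w) = ((expand m w).length, totalSize (expand m w)) := by
  induction w generalizing x with
  | nil => rfl
  | cons v w ih =>
    rw [wordFrom, wordBidegree_of_mul, ih]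
    cases v <;>
      simp only [letterGen, Gen.bidegree, expand, totalSize_cons, List.length_cons, Prod.mk_add_mk,
        Prod.mk.injEq, and_true] <;>
      omega

theorem genCocycle_homogeneous {m : ℕ} (hm : 1 ≤ m) (g : Gen m) :
    genCocycle hm g ∈ homogeneousCocycles (oddCycle m) g.bidegree.1 g.bidegree.2 := by
  intro l hl
  match g with
  | .e x =>
    have : l = [x] := by by_contra h; exact hl (if_neg h)
    rw [this]
    exact ⟨rfl, rfl⟩
  | .a x y h =>
    have : l = [x, y] := by by_contra h; exact hl (if_neg h)
    rw [this]
    exact ⟨rfl, SimpleGraph.dist_eq_one_iff_adj.2 h⟩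
  | .b x z h =>
    refine ⟨length_of_bCochain_ne_zero hl, ?_⟩
    by_contra h
    refine hl (if_neg ?_)
    rintro ⟨_, _, _, h'⟩
    exact h h'

theorem wordCocycle_homogeneous {m : ℕ} (hm : 1 ≤ m) (w : FreeSemigroup (Gen m)) :
    wordCocycle hm w ∈
      homogeneousCocycles (oddCycle m) (wordBidegree w).1 (wordBidegree w).2 := by
  induction w using FreeSemigroup.recOnMul with
  | ih1 g =>
    have : wordBidegree (FreeSemigroup.of g) = g.bidegree := by simp [wordBidegree]
    rw [this]
    exact genCocycle_homogeneous hm g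
  | ih2 g w _ ih =>
    intro l hl
    rw [map_mul] at hl
    obtain ⟨i, hi, h₁, h₂⟩ := exists_of_mulFun_ne_zero hl
    have h₁ := genCocycle_homogeneous hm g _ h₁
    have h₂ := ih _ h₂
    have h₃ := tupleLength_split (oddCycle m) l i hi
    rw [wordBidegree_of_mul]
    simp only [List.length_take, List.length_drop, Prod.fst_add, Prod.snd_add] at h₁ h₂ ⊢
    omega

theorem map_presentedGraded {m : ℕ} (hm : 2 ≤ m) (k l : ℕ) :
    (presentedGraded m k l).map (presentedMap hm : PresentedRing m →+ MH (oddCycle m)) =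
      MHGraded (oddCycle m) k l := by
  have hm1 : 1 ≤ m := by omega
  apply le_antisymm
  · rw [presentedGraded, AddMonoidHom.map_closure, AddSubgroup.closure_le]
    rintro _ ⟨_, ⟨w, hw, rfl⟩, rfl⟩
    have h := wordCocycle_homogeneous hm1 w
    rw [hw] at h
    exact ⟨_, h, (presentedMap_wordElt hm w).symm⟩
  · rintro _ ⟨z, hz, rfl⟩
    refine ⟨_, ?_, (mkMH_eq_presentedMap hm z).symm⟩
    refine sum_mem fun p hp => zsmul_mem (?_ : wordElt (p.word hm1) ∈ presentedGraded m k l) _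
    refine AddSubgroup.subset_closure ⟨p.word hm1, ?_, rfl⟩
    have h := hz _ ((finite_support hm z).mem_toFinset.1 hp)
    rw [NormalWord.simplex, length_path, tupleLength_path _ (valid_expand hm1 _)] at h
    rw [NormalWord.word, wordBidegree_wordFrom, h.2, Nat.succ_injective h.1]

theorem sum_genClass_e {m : ℕ} (hm : 1 ≤ m) :
    ∑ x, genClass hm (.e x : Gen m) = 1 := by
  have h : ∑ x, genClass hm (.e x : Gen m) = mkMH (∑ x, genCocycle hm (.e x)) :=
    (map_sum _ _ _).symm
  rw [h, ← map_one (Ideal.Quotient.mk (coboundaries (oddCycle m))), mkMH_eq_iff_evalHom hm]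
  intro p
  rw [map_sum]
  have h₁ : ∀ x, evalHom p.simplex (genCocycle hm (.e x)) =
      if p.1 = x ∧ expand m p.2.1 = [] then 1 else 0 := fun x =>
    eCochain_path x p.1 (valid_expand hm _)
  have h₂ : evalHom p.simplex (1 : cocycles (oddCycle m)) =
      if expand m p.2.1 = [] then 1 else 0 := by
    change oneFun _ = _
    rw [oneFun, NormalWord.simplex, length_path]
    simp
  simp only [h₁, h₂]
  by_cases h : expand m p.2.1 = [] <;> simp [h]

end MagnitudeCohomology

theorem theorem7p1 (m : ℕ) (hm : 2 ≤ m) :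
    ∃ Φ : PresentedRing m ≃+* MH (SimpleGraph.cycleGraph (2 * m + 1)),
      (∀ x, IsClassOf (Φ (toPresented (gen (.e x)))) (eCochain x)) ∧
      (∀ x y h, IsClassOf (Φ (toPresented (gen (.a x y h)))) (aCochain x y)) ∧
      (∀ x z h, IsClassOf (Φ (toPresented (gen (.b x z h))))
        (bCochain (SimpleGraph.cycleGraph (2 * m + 1)) (m + 1) x z)) ∧
      (∀ k l, (presentedGraded m k l).map Φ.toAddEquiv.toAddMonoidHom =
        MHGraded (SimpleGraph.cycleGraph (2 * m + 1)) k l) ∧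
      ∑ x, Φ (toPresented (gen (.e x))) = 1 := by
  have hm1 : 1 ≤ m := by omega
  have hgen : ∀ g, presentedMap hm (toPresented (gen g)) = genClass hm1 g := fun g =>
    presentedMap_wordElt hm (FreeSemigroup.of g)
  refine ⟨RingEquiv.ofBijective (presentedMap hm)
    ⟨presentedMap_injective hm, presentedMap_surjective hm⟩, ?_, ?_, ?_, ?_, ?_⟩
  · exact fun x => ⟨genCocycle hm1 (.e x), rfl, (hgen _).symm⟩
  · exact fun x y h => ⟨genCocycle hm1 (.a x y h), rfl, (hgen _).symm⟩
  · exact fun x z h => ⟨genCocycle hm1 (.b x z h), rfl, (hgen _).symm⟩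
  · exact fun k l => map_presentedGraded hm k l
  · exact (Finset.sum_congr rfl fun x _ => hgen (.e x)).trans (sum_genClass_e hm1)
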